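/- Let $1\le n\le N$ and $m_1,\dots,m_N\ge 1$ be integers, $r_1,\dots,r_N>0$ and $s_1,\dots,s_n>0$. For $m\ge1$ let $D_m=\{q\in(0,\infty)^m:\sum_{i=1}^m q_i<1\}$ and let $D=D_{m_1}\times\dots\times D_{m_N}$. For $p=(p_{i,\nu})\in D$ put $p_{0,\nu}=1-\sum_{i=1}^{m_\nu}p_{i,\nu}$. The negative multinomial distribution with shape $t>0$ and parameter $p_\nu\in D_{m_\nu}$ has mass function $$\frac{\Gamma\big(t+\sum_{i=1}^{m_\nu} x_i\big)}{\Gamma(t)\prod_{i=1}^{m_\nu} x_i!}\,p_{0,\nu}^{\,t}\prod_{i=1}^{m_\nu}p_{i,\nu}^{x_i},\qquad x\in\mathbb N_0^{m_\nu}.$$ Given $p\in D$, let $X=(X_\nu)_{\nu\le N}$ and $Y=(Y_\nu)_{\nu\le n}$ be independent vectors with independent negative multinomial components, where $X_\nu$ has shape $r_\nu$ and $Y_\nu$ has shape $s_\nu$, both with parameter $p_\nu$; let $g(y\mid p)$ be the joint mass function of $Y$. Let $\pi\ge 0$ be a (possibly improper) prior density on $D$ whose posterior given $X=x$ is proper for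 every $x$ (automatic if $\pi$ is a probability density), let $\hat g^{(\pi)}(y;x)=E_\pi[g(y\mid p)\mid X=x]$ be the Bayesian predictive mass, and let $$R(p,\hat g^{(\pi)})=E\left[\log\frac{g(Y\mid p)}{\hat g^{(\pi)}(Y;X)}\right]$$ be its Kullback–Leibler risk at $p$. Let $t_1,\dots,t_N:[0,1]\to(0,\infty)$ be smooth nondecreasing functions with $t_\nu(0)=r_\nu$ for all $\nu$, $t_\nu(1)=r_\nu+s_\nu$ for $\nu\le n$ and $t_\nu(1)=r_\nu$ for $\nu>n$. For $\tau\in[0,1]$ let $Z(\tau)=(Z_\nu(\tau))_{\nu\le N}$ have independent negative multinomial components with shapes $t_\nu(\tau)$ and parameters $p_\nu$. Write $L^{\mathrm{KL}}(d,\theta)=d-\theta-\theta\log(d/\theta)$ for $d,\theta>0$ and $\mathcal W_{\nu,k}=\{w\in\mathbb N_0^{m_\nu}:\sum_i w_i=k\}$. Then for every $p\in D$ the risk is well defined and finite, and $$R(p,\hat g^{(\pi)})=\int_0^1\Big\{\sum_{\nu=1}^n t_\nu'(\tau)\sum_{k=1}^\infty\frac1k\sum_{w\in\mathcal W_{\nu,k}}\frac{k!}{\prod_{i=1}^{m_\nu}w_i!}\,E\Big[L^{\mathrm{KL}}\Big(E_\pi\Big[\prod_{i=1}^{m_\nu}p_{i,\nu}^{w_i}\,\Big|\,Z(\tau)\Big],\prod_{i=1}^{m_\nu}p_{i,\nu}^{w_i}\Big)\Big]\Big\}\,d\tau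 .$$ All the posteriors given $Z(\tau)$ are proper, all the expectations on the right are finite, for $\tau\in(0,1]$ the series over $k$ converges whenever $t_\nu'(\tau)\neq0$ (terms with $t_\nu'(\tau)=0$ count as $0$), and the integrand is integrable over $[0,1]$. -/

import Mathlib

open MeasureTheory Set
open scoped Nat ContDiff

noncomputable section

namespace NegMult

/-- The open simplex `{p | p i > 0 for all i, ∑ i, p i < 1}`. -/
def openSimplex (m : ℕ) : Set (Fin m → ℝ) :=
  {p | (∀ i, 0 < p i) ∧ ∑ i, p i < 1}

/-- The parameter space `D`, the product of the open simplices. -/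
def paramSpace {N : ℕ} (m : Fin N → ℕ) : Set (∀ ν, Fin (m ν) → ℝ) :=
  {p | ∀ ν, p ν ∈ openSimplex (m ν)}

/-- The negative multinomial mass function with shape `r` and probability vector `p`. -/
def mass {m : ℕ} (r : ℝ) (p : Fin m → ℝ) (x : Fin m → ℕ) : ℝ :=
  Real.Gamma (r + ∑ i, (x i : ℝ)) / (Real.Gamma r * ∏ i, ((x i)! : ℝ)) *
    (1 - ∑ i, p i) ^ r * ∏ i, p i ^ x i

/-- The negative multinomial distribution, as a measure on `ℕ^m`. -/
def law {m : ℕ} (r : ℝ) (p : Fin m → ℝ) : Measure (Fin m → ℕ) :=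
  Measure.count.withDensity (fun x => ENNReal.ofReal (mass r p x))

/-- The joint mass function of independent negative multinomial vectors. -/
def jointMass {N : ℕ} {m : Fin N → ℕ} (r : Fin N → ℝ) (p : ∀ ν, Fin (m ν) → ℝ)
    (x : ∀ ν, Fin (m ν) → ℕ) : ℝ :=
  ∏ ν, mass (r ν) (p ν) (x ν)

/-- The joint law of independent negative multinomial vectors. -/
def jointLaw {N : ℕ} {m : Fin N → ℕ} (r : Fin N → ℝ) (p : ∀ ν, Fin (m ν) → ℝ) :
    Measure (∀ ν, Fin (m ν) → ℕ) :=
  Measure.pi (fun ν => law (r ν) (p ν))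

/-- `π` is a (possibly improper) prior density on `D` whose posterior, given an observation
with shape vector `r`, is proper for every value `x` of the observation. -/
def IsPrior {N : ℕ} {m : Fin N → ℕ} (r : Fin N → ℝ) (π : (∀ ν, Fin (m ν) → ℝ) → ℝ) : Prop :=
  (∀ q ∈ paramSpace m, 0 ≤ π q) ∧
    ∀ x : ∀ ν, Fin (m ν) → ℕ,
      IntegrableOn (fun q => jointMass r q x * π q) (paramSpace m) ∧
        0 < ∫ q in paramSpace m, jointMass r q x * π q

/-- The posterior mean `E_π[h(p) | X = x]`, for an observation `X` with shape vector `r`. -/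
def postMean {N : ℕ} {m : Fin N → ℕ} (r : Fin N → ℝ) (π : (∀ ν, Fin (m ν) → ℝ) → ℝ)
    (h : (∀ ν, Fin (m ν) → ℝ) → ℝ) (x : ∀ ν, Fin (m ν) → ℕ) : ℝ :=
  (∫ q in paramSpace m, h q * (jointMass r q x * π q)) /
    ∫ q in paramSpace m, jointMass r q x * π q

/-- The first `n` of the `N` blocks. -/
def firstBlocks {N n : ℕ} (hn : n ≤ N) {m : Fin N → ℕ} (p : ∀ ν, Fin (m ν) → ℝ) :
    ∀ ν : Fin n, Fin (m (Fin.castLE hn ν)) → ℝ :=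
  fun ν => p (Fin.castLE hn ν)

/-- The Bayesian predictive mass `E_π[g(y | p) | X = x]` of the future observation `Y`, whose
shape vector is `s` and whose parameters are the first `n` blocks of `p`. -/
def predMass {N n : ℕ} (hn : n ≤ N) {m : Fin N → ℕ} (r : Fin N → ℝ) (s : Fin n → ℝ)
    (π : (∀ ν, Fin (m ν) → ℝ) → ℝ) (y : ∀ ν : Fin n, Fin (m (Fin.castLE hn ν)) → ℕ)
    (x : ∀ ν, Fin (m ν) → ℕ) : ℝ :=
  postMean r π (fun q => jointMass s (firstBlocks hn q) y) x

/-- The logarithmic score difference `log (g(y | p) / ĝ(y; x))`. -/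
def logRatio {N n : ℕ} (hn : n ≤ N) {m : Fin N → ℕ} (r : Fin N → ℝ) (s : Fin n → ℝ)
    (π : (∀ ν, Fin (m ν) → ℝ) → ℝ) (p : ∀ ν, Fin (m ν) → ℝ)
    (xy : (∀ ν, Fin (m ν) → ℕ) × (∀ ν : Fin n, Fin (m (Fin.castLE hn ν)) → ℕ)) : ℝ :=
  Real.log (jointMass s (firstBlocks hn p) xy.2 / predMass hn r s π xy.2 xy.1)

/-- The joint law of the independent pair `(X, Y)`. -/
def obsLaw {N n : ℕ} (hn : n ≤ N) {m : Fin N → ℕ} (r : Fin N → ℝ) (s : Fin n → ℝ)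
    (p : ∀ ν, Fin (m ν) → ℝ) :
    Measure ((∀ ν, Fin (m ν) → ℕ) × (∀ ν : Fin n, Fin (m (Fin.castLE hn ν)) → ℕ)) :=
  (jointLaw r p).prod (jointLaw s (firstBlocks hn p))

/-- The Kullback-Leibler risk of the Bayesian predictive mass. -/
def risk {N n : ℕ} (hn : n ≤ N) {m : Fin N → ℕ} (r : Fin N → ℝ) (s : Fin n → ℝ)
    (π : (∀ ν, Fin (m ν) → ℝ) → ℝ) (p : ∀ ν, Fin (m ν) → ℝ) : ℝ :=
  ∫ xy, logRatio hn r s π p xy ∂(obsLaw hn r s p)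

/-- The weighted Stein-type loss. -/
def lossKL (d θ : ℝ) : ℝ := d - θ - θ * Real.log (d / θ)

/-- The monomial `∏ i, p i ν ^ w i` in the parameters of block `ν`. -/
def monomial {N : ℕ} {m : Fin N → ℕ} (ν : Fin N) (w : Fin (m ν) → ℕ)
    (p : ∀ ν, Fin (m ν) → ℝ) : ℝ :=
  ∏ i, p ν i ^ w i

/-- The loss of the Bayes estimator, based on the observation `z` with shape vector `t`,
of the monomial of block `ν` with exponents `w`. -/
def monomialLoss {N : ℕ} {m : Fin N → ℕ} (t : Fin N → ℝ) (π : (∀ ν, Fin (m ν) → ℝ) → ℝ)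
    (p : ∀ ν, Fin (m ν) → ℝ) (ν : Fin N) (w : Fin (m ν) → ℕ) (z : ∀ ν, Fin (m ν) → ℕ) : ℝ :=
  lossKL (postMean t π (monomial ν w) z) (monomial ν w p)

/-- `(1 / k) ∑_w (k! / ∏ i, w i !) E[monomialLoss]`, the sum being over the exponents `w` of
total degree `k`. -/
def degreeTerm {N : ℕ} {m : Fin N → ℕ} (t : Fin N → ℝ) (π : (∀ ν, Fin (m ν) → ℝ) → ℝ)
    (p : ∀ ν, Fin (m ν) → ℝ) (ν : Fin N) (k : ℕ) : ℝ :=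
  1 / (k : ℝ) * ∑ w ∈ Finset.piAntidiag (Finset.univ : Finset (Fin (m ν))) k,
    (k ! : ℝ) / (∏ i, ((w i)! : ℝ)) * ∫ z, monomialLoss t π p ν w z ∂(jointLaw t p)

end NegMult

end

/-! The negative multinomial laws with fixed parameter form a convolution semigroup in the shape,
with Lévy weights `logCoeff w * p ^ w` and total Lévy mass `-log p₀`. Two consequences drive the
proof.

The risk is an increment. Extend `Y` by zero to all `N` blocks. Then `X + Y` has shape `r + s`, the
combinatorial coefficient of `Y` cancels in the predictive ratio, and the log ratio becomes `logLik`
at `(r + s, X + Y)` minus `logLik` at `(r, X)`, where `logLik` compares the likelihood kernel at `p`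
with its prior integral `marg` (`logRatio_eq`, `integrable_logRatio_and_risk_eq`). Hence the risk is
`F 1 - F 0` for `F τ = E[logLik(Z τ)]`.

The derivative of `F` is the weighted sum of losses. Write `c_w` for `logCoeff w`. Differentiating
the mass in the shape of one block applies the Lévy generator and gives the sum of `c_w p^w
E[logLik(Z + w) - logLik(Z)]`. Differentiating `logLik` gives `log p₀` plus the posterior mean of
`-log p₀`. Expanding both logarithms by `-log p₀ = ∑ c_w p^w` turns this into the sum of `c_w
E[marg(Z + w) / marg(Z) - p^w]`. Since `marg(Z + w) / marg(Z)` is the posterior mean of `p^w`, and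
its logarithm is read off from the two values of `logLik`, the total is the sum of `c_w E[L^KL]`
(`monomialLoss_eq`, `hasSum_derivTerm`). Grouping by degree gives the stated series.

Analytically, logarithms of marginals grow at most linearly in the observation (`exists_log_bound`),
and a linear weight is absorbed by one extra unit of shape (`one_add_size_mul_jointMass_le`), so
sums are dominated uniformly in `τ`. The prior integral of `-log p₀` is controlled only when the
shape of the block exceeds its initial value. By monotonicity, each block is locally constant or
locally bounded away from its initial shape, except at one point. So `F` is continuous on `[0, 1]`
and differentiable off a finite set with nonnegative derivative, which gives both integrability and
the fundamental theorem of calculus. -/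

namespace NegMult

/-- The coefficient `t (t + 1) ⋯ (t + |z| - 1) / ∏ i, z i !` of `p ^ z` in `(1 - ∑ i, p i) ^ (-t)`. -/
noncomputable def coeff {m : ℕ} (t : ℝ) (z : Fin m → ℕ) : ℝ :=
  (∏ j ∈ Finset.range (∑ i, z i), (t + j)) / ∏ i, ((z i)! : ℝ)

/-- The coefficient of `p ^ z` in `-log (1 - ∑ i, p i)`. -/
noncomputable def logCoeff {m : ℕ} (z : Fin m → ℕ) : ℝ :=
  1 / ((∑ i, z i : ℕ) : ℝ) * (((∑ i, z i)! : ℝ) / ∏ i, ((z i)! : ℝ))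

lemma hasSum_of_eq {ι : Type*} {f g : ι → ℝ} {a : ℝ} (h : HasSum f a) (e : ∀ i, g i = f i) :
    HasSum g a := by
  rwa [show g = f from funext e]

/-! ### One block: power series coefficients, the Lévy weights and the mass function. -/

section Block

variable {m : ℕ}

lemma prod_factorial_pos (z : Fin m → ℕ) : (0 : ℝ) < ∏ i, ((z i)! : ℝ) :=
  Finset.prod_pos fun i _ => by exact_mod_cast Nat.factorial_pos _

lemma coeff_nonneg {t : ℝ} (ht : 0 ≤ t) (z : Fin m → ℕ) : 0 ≤ coeff t z :=
  div_nonneg (Finset.prod_nonneg fun _ _ => by positivity) (prod_factorial_pos z).le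

lemma coeff_pos {t : ℝ} (ht : 0 < t) (z : Fin m → ℕ) : 0 < coeff t z :=
  div_pos (Finset.prod_pos fun _ _ => by positivity) (prod_factorial_pos z)

lemma coeff_mono {s t : ℝ} (hs : 0 ≤ s) (hst : s ≤ t) (z : Fin m → ℕ) : coeff s z ≤ coeff t z :=
  div_le_div_of_nonneg_right
    (Finset.prod_le_prod (fun _ _ => by positivity) fun _ _ => by linarith) (prod_factorial_pos z).le

lemma logCoeff_nonneg (z : Fin m → ℕ) : 0 ≤ logCoeff z := by
  unfold logCoeff; positivity

@[simp] lemma logCoeff_zero : logCoeff (0 : Fin m → ℕ) = 0 := by simp [logCoeff]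

@[simp] lemma coeff_zero_right (t : ℝ) : coeff t (0 : Fin m → ℕ) = 1 := by simp [coeff]

lemma sum_add_single (z : Fin m → ℕ) (i : Fin m) :
    ∑ j, (z + Pi.single i 1 : Fin m → ℕ) j = (∑ j, z j) + 1 := by
  simp [Finset.sum_add_distrib]

lemma add_one_mul_coeff_add_single (t : ℝ) (z : Fin m → ℕ) (i : Fin m) :
    ((z i : ℝ) + 1) * coeff t (z + Pi.single i 1) = (t + (∑ j, z j : ℕ)) * coeff t z := by
  have h : ∏ j, (((z + Pi.single i 1 : Fin m → ℕ) j)! : ℝ) = ((z i : ℝ) + 1) * ∏ j, ((z j)! : ℝ) := by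
    rw [← Finset.mul_prod_erase _ _ (Finset.mem_univ i),
      ← Finset.mul_prod_erase Finset.univ (fun j => ((z j)! : ℝ)) (Finset.mem_univ i), ← mul_assoc]
    congr 1
    · simp [Nat.factorial_succ]
    · refine Finset.prod_congr rfl fun j hj => ?_
      simp [Pi.single_eq_of_ne (Finset.ne_of_mem_erase hj)]
  unfold coeff
  rw [h, sum_add_single, Finset.prod_range_succ]
  have := (prod_factorial_pos z).ne'
  have h2 : (z i : ℝ) + 1 ≠ 0 := by positivity
  field_simp

lemma single_induction {P : (Fin m → ℕ) → Prop} (h0 : P 0)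
    (h : ∀ z i, P z → P (z + Pi.single i 1)) (z : Fin m → ℕ) : P z := by
  generalize hk : ∑ j, z j = k
  induction k generalizing z with
  | zero =>
    have : z = 0 := by
      ext j; simpa using (Finset.sum_eq_zero_iff.1 hk) j (Finset.mem_univ j)
    exact this ▸ h0
  | succ k ih =>
    obtain ⟨i, -, hi⟩ : ∃ i ∈ Finset.univ, z i ≠ 0 := by
      apply Finset.exists_ne_zero_of_sum_ne_zero; omega
    have hz : z = (z - Pi.single i 1) + Pi.single i 1 := by
      ext j
      by_cases hj : j = i
      · subst hj; simp; omega
      · simp [Pi.single_eq_of_ne hj]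
    rw [hz]
    refine h _ _ (ih _ ?_)
    have := sum_add_single (z - Pi.single i 1) i
    rw [← hz] at this
    omega

lemma sum_sub_add_sum {x z : Fin m → ℕ} (h : x ≤ z) :
    ((∑ j, x j : ℕ) : ℝ) + ((∑ j, (z - x) j : ℕ) : ℝ) = (∑ j, z j : ℕ) := by
  rw [← Nat.cast_add, ← Finset.sum_add_distrib]
  congr 1
  exact Finset.sum_congr rfl fun j _ => by have : x j ≤ z j := h j; simp; omega

/-- Vandermonde's identity for rising factorials, with multi-indices. -/
lemma sum_coeff_mul_coeff (s t : ℝ) (z : Fin m → ℕ) :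
    ∑ x ∈ Finset.Iic z, coeff s x * coeff t (z - x) = coeff (s + t) z := by
  induction z using single_induction with
  | h0 =>
    have : Finset.Iic (0 : Fin m → ℕ) = {0} := by
      ext x; simp
    simp [this]
  | h z i ih =>
    have hpos : ((z i : ℝ) + 1) ≠ 0 := by positivity
    apply mul_left_cancel₀ hpos
    rw [add_one_mul_coeff_add_single, ← ih]
    set e : Fin m → ℕ := Pi.single i 1 with he
    -- The factor `z i + 1` is split as `x i + (z i + 1 - x i)`. In `hA` the first part lowers `x`,
    -- in `hB` the second part lowers the complement; boundary terms vanish because their factor is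
    -- zero. The two degrees then add up to that of `z`, which produces `s + t + ∑ z`.
    have hA : ∑ x ∈ Finset.Iic z, (s + (∑ j, x j : ℕ)) * coeff s x * coeff t (z - x)
        = ∑ x ∈ Finset.Iic (z + e), (x i : ℝ) * coeff s x * coeff t (z + e - x) := by
      refine Finset.sum_of_injOn (fun x => x + e) (fun a _ b _ h => add_right_cancel h) ?_ ?_ ?_
      · intro x hx
        simp only [Finset.coe_Iic, Set.mem_Iic] at hx ⊢
        exact add_le_add_left hx e
      · intro x hx hx'
        have : x i = 0 := by
          by_contra h0
          apply hx'
          refine ⟨x - e, ?_, ?_⟩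
          · simp only [Finset.coe_Iic, Set.mem_Iic, Finset.mem_Iic] at hx ⊢
            exact tsub_le_iff_right.2 hx
          · refine tsub_add_cancel_of_le ?_
            intro j
            by_cases hj : j = i
            · subst hj; simp [he]; omega
            · simp [he, Pi.single_eq_of_ne hj]
        simp [this]
      · intro x _
        rw [← add_one_mul_coeff_add_single s x i, add_tsub_add_eq_tsub_right]
        simp [he]
    have hB : ∑ x ∈ Finset.Iic z, coeff s x * ((t + (∑ j, (z - x) j : ℕ)) * coeff t (z - x))
        = ∑ x ∈ Finset.Iic (z + e), coeff s x * (((z i + 1 - x i : ℕ) : ℝ) * coeff t (z + e - x)) := by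
      refine Finset.sum_of_injOn id Function.injective_id.injOn ?_ ?_ ?_
      · intro x hx
        simp only [Finset.coe_Iic, Set.mem_Iic, id] at hx ⊢
        exact hx.trans (le_self_add)
      · intro x hx hx'
        have : z i + 1 ≤ x i := by
          by_contra h0
          apply hx'
          refine ⟨x, ?_, rfl⟩
          simp only [Finset.coe_Iic, Set.mem_Iic, Finset.mem_Iic] at hx ⊢
          intro j
          have : x j ≤ (z + e) j := hx j
          by_cases hj : j = i
          · subst hj
            exact Nat.lt_succ_iff.1 (not_le.1 h0)
          · simpa [he, Pi.single_eq_of_ne hj] using this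
        simp [Nat.sub_eq_zero_of_le this]
      · intro x hx
        have hx := Finset.mem_Iic.1 hx
        rw [← add_one_mul_coeff_add_single t (z - x) i, id, tsub_add_eq_add_tsub hx]
        have hxi : x i ≤ z i := hx i
        simp only [Pi.sub_apply]
        rw [show z i + 1 - x i = (z i - x i) + 1 by omega]
        push_cast; rfl
    calc ((z i : ℝ) + 1) * ∑ x ∈ Finset.Iic (z + e), coeff s x * coeff t (z + e - x)
        = ∑ x ∈ Finset.Iic (z + e), (x i : ℝ) * coeff s x * coeff t (z + e - x)
          + ∑ x ∈ Finset.Iic (z + e),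
            coeff s x * (((z i + 1 - x i : ℕ) : ℝ) * coeff t (z + e - x)) := by
          rw [Finset.mul_sum, ← Finset.sum_add_distrib]
          refine Finset.sum_congr rfl fun x hx => ?_
          have : x i ≤ (z + e) i := Finset.mem_Iic.1 hx i
          simp only [he, Pi.add_apply, Pi.single_eq_same] at this
          rw [Nat.cast_sub this]; push_cast; ring
      _ = _ := by
          rw [← hA, ← hB, ← Finset.sum_add_distrib, Finset.mul_sum]
          refine Finset.sum_congr rfl fun x hx => ?_
          rw [← sum_sub_add_sum (Finset.mem_Iic.1 hx)]
          ring

/-- For `z ≠ 0` the rising factorial has the simple factor `s`, so its derivative at `0` is the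
product of the remaining factors, a factorial of the degree minus one. -/
lemma hasDerivAt_coeff_zero (z : Fin m → ℕ) : HasDerivAt (fun s => coeff s z) (logCoeff z) 0 := by
  unfold coeff logCoeff
  rcases Nat.eq_zero_or_pos (∑ i, z i) with h | h
  · simp [h, hasDerivAt_const]
  · obtain ⟨k, hk⟩ : ∃ k, ∑ i, z i = k + 1 := ⟨_, (Nat.succ_pred_eq_of_pos h).symm⟩
    rw [hk]
    simp_rw [Finset.prod_range_succ' _ k]
    have hc : HasDerivAt (fun s : ℝ => ∏ j ∈ Finset.range k, (s + ((j + 1 : ℕ) : ℝ)))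
        (deriv (fun s : ℝ => ∏ j ∈ Finset.range k, (s + ((j + 1 : ℕ) : ℝ))) 0) 0 := by
      apply DifferentiableAt.hasDerivAt
      fun_prop
    have := (hc.mul ((hasDerivAt_id (0 : ℝ)).add_const ((0 : ℕ) : ℝ))).div_const
      (∏ i, ((z i)! : ℝ))
    refine HasDerivAt.congr_deriv (f := fun s : ℝ => ((∏ j ∈ Finset.range k,
      (s + ((j + 1 : ℕ) : ℝ))) * (s + ((0 : ℕ) : ℝ))) / ∏ i, ((z i)! : ℝ)) this ?_
    have hf : ∏ j ∈ Finset.range k, ((j : ℝ) + 1) = (k ! : ℝ) := by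
      rw [← Finset.prod_range_add_one_eq_factorial]; push_cast; rfl
    simp [hf, Nat.factorial_succ]
    field_simp

/-- By Vandermonde a change of shape from `t` is a convolution with the coefficients at the
increment, so only the derivative at shape zero is needed. -/
lemma hasDerivAt_coeff (t : ℝ) (z : Fin m → ℕ) :
    HasDerivAt (fun t => coeff t z)
      (∑ x ∈ Finset.Iic z, logCoeff x * coeff t (z - x)) t := by
  have h : HasDerivAt (fun s => ∑ x ∈ Finset.Iic z, coeff s x * coeff t (z - x))
      (∑ x ∈ Finset.Iic z, logCoeff x * coeff t (z - x)) (t - t) := by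
    rw [sub_self]
    exact HasDerivAt.fun_sum fun x _ => (hasDerivAt_coeff_zero x).mul_const _
  have := h.comp t (h := fun s => s - t) ((hasDerivAt_id t).sub_const t)
  simpa [Function.comp_def, sum_coeff_mul_coeff] using this

/-- Coefficientwise form of `-log (1 - x) ≤ 1 / (1 - x)`. It lets a convolution with the Lévy
weights be absorbed into one extra unit of shape. -/
lemma logCoeff_le_coeff_one (z : Fin m → ℕ) : logCoeff z ≤ coeff 1 z := by
  have hf : ∏ j ∈ Finset.range (∑ i, z i), ((1 : ℝ) + j) = ((∑ i, z i)! : ℝ) := by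
    rw [← Finset.prod_range_add_one_eq_factorial]; push_cast
    exact Finset.prod_congr rfl fun _ _ => add_comm _ _
  rw [coeff, hf, logCoeff]
  refine mul_le_of_le_one_left (by positivity) ?_
  rcases Nat.eq_zero_or_pos (∑ i, z i) with h | h
  · simp [h]
  · rw [div_le_one (by exact_mod_cast h)]
    exact_mod_cast h

lemma sum_logCoeff_mul_coeff_le {t : ℝ} (ht : 0 ≤ t) (z : Fin m → ℕ) :
    ∑ x ∈ Finset.Iic z, logCoeff x * coeff t (z - x) ≤ coeff (t + 1) z := by
  rw [add_comm, ← sum_coeff_mul_coeff]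
  exact Finset.sum_le_sum fun x _ =>
    mul_le_mul_of_nonneg_right (logCoeff_le_coeff_one x) (coeff_nonneg ht _)

lemma hasSum_iff_hasSum_piAntidiag {f : (Fin m → ℕ) → ℝ} (hf : ∀ w, 0 ≤ f w) (a : ℝ) :
    HasSum f a ↔
      HasSum (fun k => ∑ w ∈ Finset.piAntidiag (Finset.univ : Finset (Fin m)) k, f w) a := by
  let E := Equiv.sigmaFiberEquiv (fun w : Fin m → ℕ => ∑ i, w i)
  have hfib : ∀ k, HasSum (fun w : {w : Fin m → ℕ // ∑ i, w i = k} => f (E ⟨k, w⟩))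
      (∑ w ∈ Finset.piAntidiag (Finset.univ : Finset (Fin m)) k, f w) := by
    intro k
    have h1 := (Finset.piAntidiag (Finset.univ : Finset (Fin m)) k).hasSum f
    let e : {w : Fin m → ℕ // ∑ i, w i = k} ≃
        {w // w ∈ Finset.piAntidiag (Finset.univ : Finset (Fin m)) k} :=
      Equiv.subtypeEquivRight fun w => by simp
    exact e.hasSum_iff.2 h1
  rw [← E.hasSum_iff]
  constructor
  · intro h
    exact h.sigma hfib
  · intro h
    have hs : Summable (f ∘ E) := by
      refine (summable_sigma_of_nonneg (f := f ∘ E) (fun _ => hf _)).2 ⟨fun k => (hfib k).summable, ?_⟩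
      exact h.summable.congr fun k => (hfib k).tsum_eq.symm
    have := (hs.hasSum.sigma hfib).unique h
    rw [← this]
    exact hs.hasSum

lemma sum_piAntidiag_multinomial (q : Fin m → ℝ) (k : ℕ) :
    ∑ w ∈ Finset.piAntidiag (Finset.univ : Finset (Fin m)) k,
      (k ! : ℝ) / (∏ i, ((w i)! : ℝ)) * ∏ i, q i ^ w i = (∑ i, q i) ^ k := by
  rw [Finset.sum_pow_eq_sum_piAntidiag]
  refine Finset.sum_congr rfl fun w hw => ?_
  congr 1
  have hw : ∑ i, w i = k := by simpa using hw
  rw [div_eq_iff (prod_factorial_pos w).ne']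
  have := Nat.multinomial_spec Finset.univ w
  rw [hw] at this
  rw [← this]; push_cast; ring

lemma sum_nonneg_of_mem {q : Fin m → ℝ} (hq : q ∈ openSimplex m) : 0 ≤ ∑ i, q i :=
  Finset.sum_nonneg fun i _ => (hq.1 i).le

/-- Grouping by degree, the multinomial theorem collapses the series to the logarithmic series in `∑
q i`. -/
lemma hasSum_logCoeff {q : Fin m → ℝ} (hq : q ∈ openSimplex m) :
    HasSum (fun w => logCoeff w * ∏ i, q i ^ w i) (-Real.log (1 - ∑ i, q i)) := by
  rw [hasSum_iff_hasSum_piAntidiag fun w => mul_nonneg (logCoeff_nonneg w)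
    (Finset.prod_nonneg fun i _ => pow_nonneg (hq.1 i).le _)]
  have h : ∀ k, ∑ w ∈ Finset.piAntidiag (Finset.univ : Finset (Fin m)) k,
      logCoeff w * ∏ i, q i ^ w i = (∑ i, q i) ^ k / k := by
    intro k
    rw [← sum_piAntidiag_multinomial, Finset.sum_div]
    refine Finset.sum_congr rfl fun w hw => ?_
    have hw : ∑ i, w i = k := by simpa using hw
    rw [logCoeff, hw]; ring
  simp_rw [h]
  -- The term of degree zero is `1 / 0 = 0`, so dropping it changes nothing.
  rw [← hasSum_nat_add_iff' 1]
  simpa using Real.hasSum_pow_div_log_of_abs_lt_one (x := ∑ i, q i)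
    (by rw [abs_of_nonneg (sum_nonneg_of_mem hq)]; exact hq.2)

lemma hasSum_rising {t x : ℝ} (hx0 : 0 ≤ x) (hx : x < 1) :
    HasSum (fun k : ℕ => (∏ j ∈ Finset.range k, (t + j)) / (k ! : ℝ) * x ^ k)
      ((1 - x) ^ (-t)) := by
  have h := (Real.one_div_one_sub_rpow_hasFPowerSeriesOnBall_zero t).hasSum (y := x) (by
    simp [enorm_eq_nnnorm, ← NNReal.coe_lt_coe, abs_of_nonneg hx0, hx])
  simp only [zero_add, one_div] at h
  rw [Real.rpow_neg (by linarith)]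
  refine hasSum_of_eq h fun k => ?_
  simp only [FormalMultilinearSeries.ofScalars_apply_eq, smul_eq_mul]
  congr 1
  rw [← Ring.multichoose_eq, div_eq_iff (by positivity), mul_comm]
  have := Ring.factorial_nsmul_multichoose_eq_ascPochhammer t k
  rw [nsmul_eq_mul] at this
  rw [this, Polynomial.ascPochhammer_smeval_eq_eval]
  clear this h
  induction k with
  | zero => simp
  | succ k ih => rw [Finset.prod_range_succ, ih, ascPochhammer_succ_eval]

lemma hasSum_coeff {t : ℝ} (ht : 0 ≤ t) {q : Fin m → ℝ} (hq : q ∈ openSimplex m) :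
    HasSum (fun w => coeff t w * ∏ i, q i ^ w i) ((1 - ∑ i, q i) ^ (-t)) := by
  rw [hasSum_iff_hasSum_piAntidiag fun w => mul_nonneg (coeff_nonneg ht w)
    (Finset.prod_nonneg fun i _ => pow_nonneg (hq.1 i).le _)]
  refine hasSum_of_eq (hasSum_rising (t := t) (sum_nonneg_of_mem hq) hq.2) fun k => ?_
  rw [← sum_piAntidiag_multinomial, Finset.mul_sum]
  refine Finset.sum_congr rfl fun w hw => ?_
  have hw : ∑ i, w i = k := by simpa using hw
  have : (k ! : ℝ) ≠ 0 := by positivity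
  rw [coeff, hw]
  field_simp

lemma gamma_ratio {t : ℝ} (ht : 0 < t) (k : ℕ) :
    Real.Gamma (t + k) / Real.Gamma t = ∏ j ∈ Finset.range k, (t + j) := by
  induction k with
  | zero => simp [(Real.Gamma_pos_of_pos ht).ne']
  | succ k ih =>
    rw [Finset.prod_range_succ, ← ih, Nat.cast_succ, ← add_assoc,
      Real.Gamma_add_one (by positivity)]
    ring

lemma mass_eq {t : ℝ} (ht : 0 < t) (p : Fin m → ℝ) (z : Fin m → ℕ) :
    mass t p z = coeff t z * ((1 - ∑ i, p i) ^ t * ∏ i, p i ^ z i) := by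
  rw [mass, coeff, ← gamma_ratio ht, div_div, ← Nat.cast_sum, mul_assoc]

lemma hasSum_mass {t : ℝ} (ht : 0 < t) {p : Fin m → ℝ} (hp : p ∈ openSimplex m) :
    HasSum (mass t p) 1 := by
  have h := (hasSum_coeff ht.le hp).mul_left ((1 - ∑ i, p i) ^ t)
  have h0 : 0 < 1 - ∑ i, p i := by linarith [hp.2]
  rw [← Real.rpow_add h0, add_neg_cancel, Real.rpow_zero] at h
  refine hasSum_of_eq h fun z => ?_
  rw [mass_eq ht]; ring

end Block

/-! ### The joint likelihood kernel and lower bounds for its prior integral. -/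

section Joint

variable {N : ℕ} {m : Fin N → ℕ}

/-- The factor of the joint mass function that depends on the parameters. -/
noncomputable def kern (t : Fin N → ℝ) (q : ∀ ν, Fin (m ν) → ℝ) (z : ∀ ν, Fin (m ν) → ℕ) : ℝ :=
  ∏ ν, ((1 - ∑ i, q ν i) ^ t ν * ∏ i, q ν i ^ z ν i)

/-- The factor of the joint mass function that does not depend on the parameters. -/
noncomputable def jointCoeff (t : Fin N → ℝ) (z : ∀ ν, Fin (m ν) → ℕ) : ℝ :=
  ∏ ν, coeff (t ν) (z ν)

/-- The integral of `kern` against the prior. -/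
noncomputable def marg (t : Fin N → ℝ) (π : (∀ ν, Fin (m ν) → ℝ) → ℝ)
    (z : ∀ ν, Fin (m ν) → ℕ) : ℝ :=
  ∫ q in paramSpace m, kern t q z * π q

/-- The integral of `-log (1 - ∑ i, q ν i) * kern` against the prior. -/
noncomputable def logMarg (t : Fin N → ℝ) (π : (∀ ν, Fin (m ν) → ℝ) → ℝ) (ν : Fin N)
    (z : ∀ ν, Fin (m ν) → ℕ) : ℝ :=
  ∫ q in paramSpace m, -Real.log (1 - ∑ i, q ν i) * (kern t q z * π q)

/-- The logarithm of the ratio of the likelihood at `p` and the marginal likelihood. -/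
noncomputable def logLik (t : Fin N → ℝ) (π : (∀ ν, Fin (m ν) → ℝ) → ℝ)
    (p : ∀ ν, Fin (m ν) → ℝ) (z : ∀ ν, Fin (m ν) → ℕ) : ℝ :=
  Real.log (kern t p z) - Real.log (marg t π z)

/-- The total degree of `z`. -/
def size (z : ∀ ν, Fin (m ν) → ℕ) : ℝ := ∑ ν, ∑ i, (z ν i : ℝ)

lemma size_nonneg (z : ∀ ν, Fin (m ν) → ℕ) : 0 ≤ size z := by unfold size; positivity

lemma size_add (z w : ∀ ν, Fin (m ν) → ℕ) : size (z + w) = size z + size w := by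
  simp [size, Finset.sum_add_distrib]

lemma size_single (ν : Fin N) (w : Fin (m ν) → ℕ) :
    size (Pi.single ν w : ∀ ν, Fin (m ν) → ℕ) = ∑ i, (w i : ℝ) := by
  rw [size, Finset.sum_eq_single ν]
  · simp
  · intro j _ hj; simp [Pi.single_eq_of_ne hj]
  · simp

lemma one_sub_pos {q : ∀ ν, Fin (m ν) → ℝ} (hq : q ∈ paramSpace m) (ν : Fin N) :
    0 < 1 - ∑ i, q ν i := by linarith [(hq ν).2]

lemma one_sub_le_one {q : ∀ ν, Fin (m ν) → ℝ} (hq : q ∈ paramSpace m) (ν : Fin N) :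
    1 - ∑ i, q ν i ≤ 1 := by linarith [sum_nonneg_of_mem (hq ν)]

lemma le_one_of_mem {q : ∀ ν, Fin (m ν) → ℝ} (hq : q ∈ paramSpace m) (ν : Fin N)
    (i : Fin (m ν)) : q ν i ≤ 1 :=
  (Finset.single_le_sum (fun j _ => ((hq ν).1 j).le) (Finset.mem_univ i)).trans (hq ν).2.le

lemma kern_pos {q : ∀ ν, Fin (m ν) → ℝ} (hq : q ∈ paramSpace m) (t : Fin N → ℝ)
    (z : ∀ ν, Fin (m ν) → ℕ) : 0 < kern t q z :=
  Finset.prod_pos fun ν _ => mul_pos (Real.rpow_pos_of_pos (one_sub_pos hq ν) _)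
    (Finset.prod_pos fun i _ => pow_pos ((hq ν).1 i) _)

lemma kern_add {q : ∀ ν, Fin (m ν) → ℝ} (hq : q ∈ paramSpace m) (t s : Fin N → ℝ)
    (z w : ∀ ν, Fin (m ν) → ℕ) : kern (t + s) q (z + w) = kern t q z * kern s q w := by
  simp only [kern, ← Finset.prod_mul_distrib, Pi.add_apply, pow_add,
    Real.rpow_add (one_sub_pos hq _)]
  exact Finset.prod_congr rfl fun ν _ => by rw [Finset.prod_mul_distrib]; ring

lemma kern_le_one {q : ∀ ν, Fin (m ν) → ℝ} (hq : q ∈ paramSpace m) {t : Fin N → ℝ} (ht : 0 ≤ t)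
    (z : ∀ ν, Fin (m ν) → ℕ) : kern t q z ≤ 1 :=
  Finset.prod_le_one (fun ν _ => mul_nonneg (Real.rpow_nonneg (one_sub_pos hq ν).le _)
    (Finset.prod_nonneg fun i _ => pow_nonneg ((hq ν).1 i).le _)) fun ν _ =>
    mul_le_one₀ (Real.rpow_le_one (one_sub_pos hq ν).le (one_sub_le_one hq ν) (ht ν))
      (Finset.prod_nonneg fun i _ => pow_nonneg ((hq ν).1 i).le _)
      (Finset.prod_le_one (fun i _ => pow_nonneg ((hq ν).1 i).le _)
        fun i _ => pow_le_one₀ ((hq ν).1 i).le (le_one_of_mem hq ν i))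

lemma kern_eq_mul {q : ∀ ν, Fin (m ν) → ℝ} (hq : q ∈ paramSpace m) (r t : Fin N → ℝ)
    (z : ∀ ν, Fin (m ν) → ℕ) : kern t q z = kern r q 0 * kern (t - r) q z := by
  rw [← kern_add hq, zero_add, add_sub_cancel]

lemma kern_le_kern {q : ∀ ν, Fin (m ν) → ℝ} (hq : q ∈ paramSpace m) {r t : Fin N → ℝ}
    (h : r ≤ t) (z : ∀ ν, Fin (m ν) → ℕ) : kern t q z ≤ kern r q 0 := by
  rw [kern_eq_mul hq r]
  exact mul_le_of_le_one_right (kern_pos hq _ _).le (kern_le_one hq (sub_nonneg.2 h) z)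

lemma kern_zero_single (ν : Fin N) (w : Fin (m ν) → ℕ) (q : ∀ ν, Fin (m ν) → ℝ) :
    kern 0 q (Pi.single ν w) = monomial ν w q := by
  rw [kern, Finset.prod_eq_single ν]
  · simp [monomial]
  · intro j _ hj; simp [Pi.single_eq_of_ne hj]
  · simp

lemma kern_single_zero (ν : Fin N) (δ : ℝ) (q : ∀ ν, Fin (m ν) → ℝ) :
    kern (Pi.single ν δ) q 0 = (1 - ∑ i, q ν i) ^ δ := by
  rw [kern, Finset.prod_eq_single ν]
  · simp
  · intro j _ hj; simp [Pi.single_eq_of_ne hj]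
  · simp

lemma kern_add_single {q : ∀ ν, Fin (m ν) → ℝ} (hq : q ∈ paramSpace m) (t : Fin N → ℝ)
    (z : ∀ ν, Fin (m ν) → ℕ) (ν : Fin N) (w : Fin (m ν) → ℕ) :
    kern t q (z + Pi.single ν w) = monomial ν w q * kern t q z := by
  have := kern_add hq t 0 z (Pi.single ν w)
  rw [add_zero, kern_zero_single] at this
  rw [this, mul_comm]

lemma log_kern {q : ∀ ν, Fin (m ν) → ℝ} (hq : q ∈ paramSpace m) (t : Fin N → ℝ)
    (z : ∀ ν, Fin (m ν) → ℕ) :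
    Real.log (kern t q z) = ∑ ν, (t ν * Real.log (1 - ∑ i, q ν i)
      + ∑ i, z ν i * Real.log (q ν i)) := by
  have h1 : ∀ ν, (1 - ∑ i, q ν i) ^ t ν ≠ 0 := fun ν =>
    (Real.rpow_pos_of_pos (one_sub_pos hq ν) _).ne'
  have h2 : ∀ ν i, q ν i ^ z ν i ≠ 0 := fun ν i => pow_ne_zero _ ((hq ν).1 i).ne'
  rw [kern, Real.log_prod fun ν _ => mul_ne_zero (h1 ν) (Finset.prod_ne_zero_iff.2 fun i _ => h2 ν i)]
  refine Finset.sum_congr rfl fun ν _ => ?_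
  rw [Real.log_mul (h1 ν) (Finset.prod_ne_zero_iff.2 fun i _ => h2 ν i),
    Real.log_rpow (one_sub_pos hq ν), Real.log_prod fun i _ => h2 ν i]
  simp [Real.log_pow]

lemma isOpen_paramSpace : IsOpen (paramSpace m) := by
  have : paramSpace m = ⋂ ν, ({q | 1 - ∑ i, q ν i > 0} ∩ ⋂ i, {q | 0 < q ν i}) := by
    ext q
    simp only [paramSpace, openSimplex, Set.mem_ofPred_eq, Set.mem_iInter, Set.mem_inter_iff]
    exact forall_congr' fun ν => ⟨fun h => ⟨by linarith [h.2], h.1⟩,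
      fun h => ⟨h.2, by linarith [h.1]⟩⟩
  rw [this]
  refine isOpen_iInter_of_finite fun ν => (isOpen_lt (by fun_prop) (by fun_prop)).inter
    (isOpen_iInter_of_finite fun i => isOpen_lt (by fun_prop) (by fun_prop))

lemma measurableSet_paramSpace : MeasurableSet (paramSpace m) := isOpen_paramSpace.measurableSet

lemma measurable_kern (t : Fin N → ℝ) (z : ∀ ν, Fin (m ν) → ℕ) :
    Measurable fun q : ∀ ν, Fin (m ν) → ℝ => kern t q z := by
  unfold kern
  fun_prop

lemma jointMass_eq {t : Fin N → ℝ} (ht : ∀ ν, 0 < t ν) (q : ∀ ν, Fin (m ν) → ℝ)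
    (z : ∀ ν, Fin (m ν) → ℕ) : jointMass t q z = jointCoeff t z * kern t q z := by
  simp only [jointMass, jointCoeff, kern, ← Finset.prod_mul_distrib]
  exact Finset.prod_congr rfl fun ν _ => mass_eq (ht ν) _ _

lemma jointCoeff_pos {t : Fin N → ℝ} (ht : ∀ ν, 0 < t ν) (z : ∀ ν, Fin (m ν) → ℕ) :
    0 < jointCoeff t z := Finset.prod_pos fun ν _ => coeff_pos (ht ν) _

lemma jointCoeff_mono {s t : Fin N → ℝ} (hs : ∀ ν, 0 ≤ s ν) (hst : s ≤ t)
    (z : ∀ ν, Fin (m ν) → ℕ) : jointCoeff s z ≤ jointCoeff t z :=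
  Finset.prod_le_prod (fun ν _ => coeff_nonneg (hs ν) _) fun ν _ => coeff_mono (hs ν) (hst ν) _

lemma jointMass_pos {t : Fin N → ℝ} (ht : ∀ ν, 0 < t ν) {q : ∀ ν, Fin (m ν) → ℝ}
    (hq : q ∈ paramSpace m) (z : ∀ ν, Fin (m ν) → ℕ) : 0 < jointMass t q z := by
  rw [jointMass_eq ht]; exact mul_pos (jointCoeff_pos ht z) (kern_pos hq _ _)

/-- A prior that is nonnegative and integrates the likelihood of the observation `0` to a positive
number. -/
structure KernPrior (r : Fin N → ℝ) (π : (∀ ν, Fin (m ν) → ℝ) → ℝ) : Prop where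
  nonneg : ∀ q ∈ paramSpace m, 0 ≤ π q
  integrableOn : IntegrableOn (fun q => kern r q 0 * π q) (paramSpace m)
  marg_pos : 0 < marg r π 0

lemma IsPrior.kernPrior {r : Fin N → ℝ} (hr : ∀ ν, 0 < r ν) {π : (∀ ν, Fin (m ν) → ℝ) → ℝ}
    (h : IsPrior r π) : KernPrior r π := by
  have h0 : jointCoeff r (0 : ∀ ν, Fin (m ν) → ℕ) = 1 := by simp [jointCoeff]
  have := h.2 0
  simp only [jointMass_eq hr, h0, one_mul] at this
  exact ⟨h.1, this.1, this.2⟩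

namespace KernPrior

variable {r t : Fin N → ℝ} {π : (∀ ν, Fin (m ν) → ℝ) → ℝ}

lemma integrableOn_kern (h : KernPrior r π) (hrt : r ≤ t) (z : ∀ ν, Fin (m ν) → ℕ) :
    IntegrableOn (fun q => kern t q z * π q) (paramSpace m) := by
  have h1 : IntegrableOn (fun q => kern (t - r) q z * (kern r q 0 * π q)) (paramSpace m) := by
    refine h.integrableOn.bdd_mul (c := 1) (measurable_kern _ _).aestronglyMeasurable ?_
    filter_upwards [ae_restrict_mem measurableSet_paramSpace] with q hq
    rw [Real.norm_of_nonneg (kern_pos hq _ _).le]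
    exact kern_le_one hq (sub_nonneg.2 hrt) z
  refine h1.congr_fun (fun q hq => ?_) measurableSet_paramSpace
  rw [kern_eq_mul hq r t]; ring

lemma marg_le (h : KernPrior r π) (hrt : r ≤ t) (z : ∀ ν, Fin (m ν) → ℕ) :
    marg t π z ≤ marg r π 0 :=
  setIntegral_mono_on (h.integrableOn_kern hrt z) h.integrableOn measurableSet_paramSpace
    fun q hq => mul_le_mul_of_nonneg_right (kern_le_kern hq hrt z) (h.nonneg q hq)

/-- The sets where all cell probabilities are at least `1 / (j + 1)` exhaust the parameter space, so
for some `j` one of them already carries positive mass of the base kernel times the prior. There the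
additional kernel is at least `ε` to the power of the added shape and degree. Thus marginals decay
at most geometrically. -/
lemma exists_le_marg (h : KernPrior r π) : ∃ c > 0, ∃ ε > 0, ε ≤ 1 ∧ ∀ t, r ≤ t →
    ∀ z : ∀ ν, Fin (m ν) → ℕ, c * ε ^ (∑ ν, (t ν - r ν) + size z) ≤ marg t π z := by
  let E : ℕ → Set (∀ ν, Fin (m ν) → ℝ) := fun j => paramSpace m ∩
    {q | ∀ ν, 1 / ((j : ℝ) + 1) ≤ 1 - ∑ i, q ν i ∧ ∀ i, 1 / ((j : ℝ) + 1) ≤ q ν i}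
  have hEm : ∀ j, MeasurableSet (E j) := by
    intro j
    refine measurableSet_paramSpace.inter (IsClosed.measurableSet ?_)
    simp only [Set.ofPred_forall, Set.ofPred_and]
    exact isClosed_iInter fun ν => (isClosed_le (by fun_prop) (by fun_prop)).inter
      (isClosed_iInter fun i => isClosed_le (by fun_prop) (by fun_prop))
  have hEmono : Monotone E := by
    intro j k hjk q hq
    have : 1 / ((k : ℝ) + 1) ≤ 1 / ((j : ℝ) + 1) := by gcongr
    exact ⟨hq.1, fun ν => ⟨this.trans (hq.2 ν).1, fun i => this.trans ((hq.2 ν).2 i)⟩⟩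
  have hEU : ⋃ j, E j = paramSpace m := by
    apply Set.Subset.antisymm (Set.iUnion_subset fun j => Set.inter_subset_left)
    intro q hq
    have hev : ∀ x : ℝ, 0 < x → ∀ᶠ j : ℕ in Filter.atTop, 1 / ((j : ℝ) + 1) ≤ x := fun x hx =>
      (tendsto_one_div_add_atTop_nhds_zero_nat.eventually (gt_mem_nhds hx)).mono fun _ h => h.le
    have : ∀ᶠ j : ℕ in Filter.atTop, ∀ ν, 1 / ((j : ℝ) + 1) ≤ 1 - ∑ i, q ν i ∧
        ∀ i, 1 / ((j : ℝ) + 1) ≤ q ν i := by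
      refine Filter.eventually_all.2 fun ν => (hev _ (one_sub_pos hq ν)).and ?_
      exact Filter.eventually_all.2 fun i => hev _ ((hq ν).1 i)
    obtain ⟨j, hj⟩ := this.exists
    exact Set.mem_iUnion.2 ⟨j, hq, hj⟩
  have hlim := tendsto_setIntegral_of_monotone hEm hEmono (f := fun q => kern r q 0 * π q)
    (μ := volume) (by rw [hEU]; exact h.integrableOn)
  rw [hEU] at hlim
  obtain ⟨j, hj⟩ := (hlim.eventually (lt_mem_nhds h.marg_pos)).exists
  have hε : (0 : ℝ) < 1 / ((j : ℝ) + 1) := by positivity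
  refine ⟨_, hj, 1 / ((j : ℝ) + 1), hε, ?_, ?_⟩
  · rw [div_le_one (by positivity)]; linarith [(Nat.cast_nonneg j : (0 : ℝ) ≤ j)]
  intro t hrt z
  set ε : ℝ := 1 / ((j : ℝ) + 1)
  have hk : ∀ q ∈ E j, ε ^ (∑ ν, (t ν - r ν) + size z) ≤ kern (t - r) q z := by
    intro q hq
    have : ε ^ (∑ ν, (t ν - r ν) + size z) = ∏ ν, (ε ^ (t ν - r ν) * ∏ i, ε ^ z ν i) := by
      rw [Real.rpow_add hε, Finset.prod_mul_distrib, Real.rpow_sum_of_pos hε, size,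
        Real.rpow_sum_of_pos hε]
      congr 1
      refine Finset.prod_congr rfl fun ν _ => ?_
      rw [Real.rpow_sum_of_pos hε]
      simp
    rw [this, kern]
    refine Finset.prod_le_prod (fun ν _ => by positivity) fun ν _ => ?_
    have := hq.2 ν
    have h1 : ε ^ (t ν - r ν) ≤ (1 - ∑ i, q ν i) ^ (t - r) ν :=
      Real.rpow_le_rpow hε.le this.1 (sub_nonneg.2 (hrt ν))
    have h2 : ∏ i, ε ^ z ν i ≤ ∏ i, q ν i ^ z ν i :=
      Finset.prod_le_prod (fun i _ => by positivity) fun i _ =>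
        pow_le_pow_left₀ hε.le (this.2 i) _
    exact mul_le_mul h1 h2 (by positivity) (Real.rpow_nonneg (one_sub_pos hq.1 ν).le _)
  calc _ = ∫ q in E j, ε ^ (∑ ν, (t ν - r ν) + size z) * (kern r q 0 * π q) := by
        rw [integral_const_mul, mul_comm]
    _ ≤ ∫ q in E j, kern t q z * π q := by
        refine setIntegral_mono_on ((h.integrableOn.mono_set Set.inter_subset_left).const_mul _)
          ((h.integrableOn_kern hrt z).mono_set Set.inter_subset_left) (hEm j) fun q hq => ?_
        rw [kern_eq_mul hq.1 r t,
          show kern r q 0 * kern (t - r) q z * π q = kern (t - r) q z * (kern r q 0 * π q) by ring]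
        exact mul_le_mul_of_nonneg_right (hk q hq)
          (mul_nonneg (kern_pos hq.1 _ _).le (h.nonneg q hq.1))
    _ ≤ marg t π z := by
        refine setIntegral_mono_set (h.integrableOn_kern hrt z) ?_
          (Set.inter_subset_left.eventuallyLE)
        filter_upwards [ae_restrict_mem measurableSet_paramSpace] with q hq
        exact mul_nonneg (kern_pos hq _ _).le (h.nonneg q hq)

lemma marg_pos_of_le (h : KernPrior r π) (hrt : r ≤ t) (z : ∀ ν, Fin (m ν) → ℕ) :
    0 < marg t π z := by
  obtain ⟨c, hc, ε, hε, -, H⟩ := h.exists_le_marg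
  exact (mul_pos hc (Real.rpow_pos_of_pos hε _)).trans_le (H t hrt z)

/-- Larger shapes and further observations multiply the base kernel by a factor in `(0, 1]`, so
propriety at the observation `0` with shape `r` is enough. -/
lemma isPrior (h : KernPrior r π) (hrt : r ≤ t) (ht : ∀ ν, 0 < t ν) : IsPrior t π := by
  refine ⟨h.nonneg, fun x => ?_⟩
  simp only [jointMass_eq ht, mul_assoc]
  refine ⟨(h.integrableOn_kern hrt x).const_mul _, ?_⟩
  rw [integral_const_mul]
  exact mul_pos (jointCoeff_pos ht x) (h.marg_pos_of_le hrt x)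

/-- The logarithms of the marginal likelihood and of the likelihood grow at most linearly. -/
lemma exists_log_bound (h : KernPrior r π) (hr : 0 ≤ r) {p : ∀ ν, Fin (m ν) → ℝ}
    (hp : p ∈ paramSpace m) (T : Fin N → ℝ) :
    ∃ C : ℝ, 0 ≤ C ∧ ∀ t, r ≤ t → t ≤ T → ∀ z : ∀ ν, Fin (m ν) → ℕ,
      |Real.log (marg t π z)| ≤ C * (1 + size z) ∧ |logLik t π p z| ≤ C * (1 + size z) := by
  obtain ⟨c, hc, ε, hε, hε1, H⟩ := h.exists_le_marg
  have hlogε : Real.log ε ≤ 0 := Real.log_nonpos hε.le hε1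
  -- The first two summands bound the lower estimate at `size z = 0`, the third covers the upper
  -- estimate, and `-Real.log ε` is the slope in `size z`.
  set A : ℝ := |Real.log c| + (∑ ν, |T ν - r ν|) * (-Real.log ε) + |Real.log (marg r π 0)|
    - Real.log ε with hA
  have hS0 : 0 ≤ ∑ ν, |T ν - r ν| := Finset.sum_nonneg fun _ _ => abs_nonneg _
  have hA0 : 0 ≤ A := by
    have := abs_nonneg (Real.log c)
    have := abs_nonneg (Real.log (marg r π 0))
    have := mul_nonneg hS0 (neg_nonneg.2 hlogε)
    linarith
  set B : ℝ := ∑ ν, (|T ν| * |Real.log (1 - ∑ i, p ν i)| + ∑ i, |Real.log (p ν i)|) with hB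
  have hB0 : 0 ≤ B := by positivity
  have h1 : ∀ t, r ≤ t → t ≤ T → ∀ z : ∀ ν, Fin (m ν) → ℕ,
      |Real.log (marg t π z)| ≤ A * (1 + size z) := by
    intro t hrt htT z
    have hsz := size_nonneg z
    have hS : ∑ ν, (t ν - r ν) ≤ ∑ ν, |T ν - r ν| := Finset.sum_le_sum fun ν _ =>
      (by linarith [htT ν] : t ν - r ν ≤ T ν - r ν).trans (le_abs_self _)
    have hmz := h.marg_pos_of_le hrt z
    have hlow : Real.log c + (∑ ν, (t ν - r ν) + size z) * Real.log ε ≤ Real.log (marg t π z) := by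
      rw [← Real.log_rpow hε, ← Real.log_mul hc.ne' (Real.rpow_pos_of_pos hε _).ne']
      exact Real.log_le_log (mul_pos hc (Real.rpow_pos_of_pos hε _)) (H t hrt z)
    have hup : Real.log (marg t π z) ≤ Real.log (marg r π 0) :=
      Real.log_le_log hmz (h.marg_le hrt z)
    have e1 := mul_le_mul_of_nonneg_right hS (neg_nonneg.2 hlogε)
    have e2 := neg_abs_le (Real.log c)
    have e3 := le_abs_self (Real.log (marg r π 0))
    have e4 := abs_nonneg (Real.log (marg r π 0))
    have e5 := abs_nonneg (Real.log c)
    have e6 := mul_nonneg hS0 (neg_nonneg.2 hlogε)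
    have e7 : -Real.log ε * size z ≤ A * size z :=
      mul_le_mul_of_nonneg_right (by linarith) hsz
    rw [abs_le]
    constructor
    · nlinarith
    · nlinarith [mul_nonneg hA0 hsz]
  have h2 : ∀ t, r ≤ t → t ≤ T → ∀ z : ∀ ν, Fin (m ν) → ℕ,
      |Real.log (kern t p z)| ≤ B * (1 + size z) := by
    intro t hrt htT z
    rw [log_kern hp, hB, Finset.sum_mul]
    refine (Finset.abs_sum_le_sum_abs _ _).trans (Finset.sum_le_sum fun ν _ => ?_)
    have hsz := size_nonneg z
    refine (abs_add_le _ _).trans ?_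
    rw [add_mul, abs_mul]
    refine add_le_add ?_ ?_
    · have htν : |t ν| ≤ |T ν| := by
        have h0 : 0 ≤ t ν := (hr ν).trans (hrt ν)
        rw [abs_of_nonneg h0]; exact (htT ν).trans (le_abs_self _)
      calc |t ν| * |Real.log (1 - ∑ i, p ν i)| ≤ |T ν| * |Real.log (1 - ∑ i, p ν i)| := by gcongr
        _ ≤ _ := le_mul_of_one_le_right (by positivity) (by linarith)
    · rw [Finset.sum_mul]
      refine (Finset.abs_sum_le_sum_abs _ _).trans (Finset.sum_le_sum fun i _ => ?_)
      rw [abs_mul, mul_comm, Nat.abs_cast]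
      gcongr
      have : (z ν i : ℝ) ≤ size z :=
        (Finset.single_le_sum (f := fun i => (z ν i : ℝ)) (fun j _ => by positivity)
          (Finset.mem_univ i)).trans
        (Finset.single_le_sum (f := fun ν => ∑ i, (z ν i : ℝ)) (fun j _ => by positivity)
          (Finset.mem_univ ν))
      linarith
  refine ⟨A + B, by positivity, fun t hrt htT z => ⟨?_, ?_⟩⟩
  · have := mul_nonneg hB0 (by linarith [size_nonneg z] : 0 ≤ 1 + size z)
    linarith [h1 t hrt htT z]
  · rw [logLik]
    refine (abs_sub _ _).trans ?_
    linarith [h1 t hrt htT z, h2 t hrt htT z]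

end KernPrior

end Joint

/-! ### The logarithmic prior integral and differentiation of the marginal. -/

section Joint

variable {N : ℕ} {m : Fin N → ℕ}

/-- Any positive power absorbs the logarithmic singularity at zero; a spare amount `δ` of shape
supplies that power. -/
lemma neg_log_mul_rpow_le {x δ : ℝ} (hx : 0 < x) (hδ : 0 < δ) :
    -Real.log x * x ^ δ ≤ 1 / δ := by
  have h1 : Real.log (x ^ (-δ)) ≤ x ^ (-δ) := by
    have := Real.log_le_sub_one_of_pos (Real.rpow_pos_of_pos hx (-δ))
    linarith
  rw [Real.log_rpow hx] at h1
  have h2 := mul_le_mul_of_nonneg_right h1 (Real.rpow_pos_of_pos hx δ).le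
  rw [← Real.rpow_add hx, neg_add_cancel, Real.rpow_zero] at h2
  rw [le_div_iff₀ hδ]
  linarith

lemma le_sub_single {r t : Fin N → ℝ} {ν : Fin N} {δ : ℝ} (hrt : r ≤ t) (hν : r ν + δ ≤ t ν) :
    r ≤ t - Pi.single ν δ := by
  intro j
  by_cases hj : j = ν
  · subst hj; simp; linarith
  · simpa [Pi.single_eq_of_ne hj] using hrt j

lemma neg_log_nonneg {q : ∀ ν, Fin (m ν) → ℝ} (hq : q ∈ paramSpace m) (ν : Fin N) :
    0 ≤ -Real.log (1 - ∑ i, q ν i) :=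
  neg_nonneg.2 (Real.log_nonpos (one_sub_pos hq ν).le (one_sub_le_one hq ν))

lemma kern_eq_kern_sub_single {q : ∀ ν, Fin (m ν) → ℝ} (hq : q ∈ paramSpace m)
    (t : Fin N → ℝ) (ν : Fin N) (δ : ℝ) (z : ∀ ν, Fin (m ν) → ℕ) :
    kern t q z = kern (t - Pi.single ν δ) q z * (1 - ∑ i, q ν i) ^ δ := by
  rw [← kern_single_zero, ← kern_add hq, sub_add_cancel, add_zero]

lemma neg_log_mul_kern_le {q : ∀ ν, Fin (m ν) → ℝ} (hq : q ∈ paramSpace m) {r t : Fin N → ℝ}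
    {ν : Fin N} {δ : ℝ} (hδ : 0 < δ) (hrt : r ≤ t) (hν : r ν + δ ≤ t ν)
    (z : ∀ ν, Fin (m ν) → ℕ) :
    -Real.log (1 - ∑ i, q ν i) * kern t q z ≤ 1 / δ * kern r q 0 := by
  rw [kern_eq_kern_sub_single hq t ν δ, mul_left_comm, mul_comm]
  exact mul_le_mul (neg_log_mul_rpow_le (one_sub_pos hq ν) hδ)
    (kern_le_kern hq (le_sub_single hrt hν) z) (kern_pos hq _ _).le (by positivity)

lemma measurable_log_one_sub (ν : Fin N) :
    Measurable fun q : ∀ ν, Fin (m ν) → ℝ => -Real.log (1 - ∑ i, q ν i) := by fun_prop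

namespace KernPrior

variable {r t : Fin N → ℝ} {π : (∀ ν, Fin (m ν) → ℝ) → ℝ}

lemma integrableOn_log (h : KernPrior r π) {ν : Fin N} {δ : ℝ} (hδ : 0 < δ) (hrt : r ≤ t)
    (hν : r ν + δ ≤ t ν) (z : ∀ ν, Fin (m ν) → ℕ) :
    IntegrableOn (fun q => -Real.log (1 - ∑ i, q ν i) * (kern t q z * π q)) (paramSpace m) := by
  refine Integrable.mono' (h.integrableOn.const_mul (1 / δ))
    ((measurable_log_one_sub ν).aestronglyMeasurable.mul
      (h.integrableOn_kern hrt z).aestronglyMeasurable) ?_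
  filter_upwards [ae_restrict_mem measurableSet_paramSpace] with q hq
  rw [Real.norm_of_nonneg (mul_nonneg (neg_log_nonneg hq ν)
    (mul_nonneg (kern_pos hq _ _).le (h.nonneg q hq))), ← mul_assoc, ← mul_assoc]
  exact mul_le_mul_of_nonneg_right (neg_log_mul_kern_le hq hδ hrt hν z) (h.nonneg q hq)

lemma logMarg_nonneg (h : KernPrior r π) (t : Fin N → ℝ) (ν : Fin N) (z : ∀ ν, Fin (m ν) → ℕ) :
    0 ≤ logMarg t π ν z :=
  setIntegral_nonneg measurableSet_paramSpace fun q hq => mul_nonneg (neg_log_nonneg hq ν)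
    (mul_nonneg (kern_pos hq _ _).le (h.nonneg q hq))

/-- Jensen's inequality under the posterior: the mean of `log (x ^ (-δ))` is at most the log of the
mean of `x ^ (-δ)`, and that mean is the ratio of the marginals at shapes lowered by `δ` and not
lowered. Being a difference of log marginals, the bound grows only linearly in the observation. -/
lemma logMarg_le (h : KernPrior r π) {ν : Fin N} {δ : ℝ} (hδ : 0 < δ) (hrt : r ≤ t)
    (hν : r ν + δ ≤ t ν) (z : ∀ ν, Fin (m ν) → ℕ) :
    logMarg t π ν z ≤ marg t π z *
      (1 / δ * (Real.log (marg (t - Pi.single ν δ) π z) - Real.log (marg t π z))) := by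
  have hrt' := le_sub_single hrt hν
  set M := marg t π z with hM
  set M' := marg (t - Pi.single ν δ) π z with hM'
  have hMp : 0 < M := h.marg_pos_of_le hrt z
  have hMp' : 0 < M' := h.marg_pos_of_le hrt' z
  have ha : 0 < M' / M := div_pos hMp' hMp
  -- The tangent line of `log` at the mean `M' / M`; it becomes Jensen's inequality after
  -- integration.
  have hpt : ∀ q ∈ paramSpace m, -Real.log (1 - ∑ i, q ν i) * (kern t q z * π q) ≤
      1 / δ * ((M' / M)⁻¹ * (kern (t - Pi.single ν δ) q z * π q)
        + (Real.log (M' / M) - 1) * (kern t q z * π q)) := by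
    intro q hq
    have hx := one_sub_pos hq ν
    set x := 1 - ∑ i, q ν i
    have hlog : -δ * Real.log x ≤ x ^ (-δ) * (M' / M)⁻¹ + Real.log (M' / M) - 1 := by
      have h1 := Real.log_le_sub_one_of_pos
        (mul_pos (Real.rpow_pos_of_pos hx (-δ)) (inv_pos.2 ha))
      rw [Real.log_mul (Real.rpow_pos_of_pos hx _).ne' (inv_pos.2 ha).ne', Real.log_rpow hx,
        Real.log_inv] at h1
      linarith
    have hk : kern (t - Pi.single ν δ) q z = x ^ (-δ) * kern t q z := by
      rw [kern_eq_kern_sub_single hq t ν δ, mul_left_comm, ← Real.rpow_add hx, neg_add_cancel,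
        Real.rpow_zero, mul_one]
    have h2 := mul_le_mul_of_nonneg_right hlog
      (mul_nonneg (kern_pos hq t z).le (h.nonneg q hq))
    rw [hk, one_div, ← div_eq_inv_mul, le_div_iff₀ hδ]
    linarith
  have i1 := (h.integrableOn_kern hrt' z).const_mul (M' / M)⁻¹
  have i2 := (h.integrableOn_kern hrt z).const_mul (Real.log (M' / M) - 1)
  have := setIntegral_mono_on (h.integrableOn_log hδ hrt hν z) ((i1.add i2).const_mul (1 / δ))
    measurableSet_paramSpace hpt
  refine this.trans (le_of_eq ?_)
  rw [integral_const_mul]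
  simp only [Pi.add_apply]
  rw [integral_add i1 i2, integral_const_mul, integral_const_mul]
  change 1 / δ * ((M' / M)⁻¹ * M' + (Real.log (M' / M) - 1) * M) = _
  rw [Real.log_div hMp'.ne' hMp.ne']
  field_simp
  ring

/-- Expand `-log p₀` in monomials under the integral; each monomial shifts the observation. All
terms are nonnegative, so they serve as their own dominating series. -/
lemma hasSum_marg_add_single (h : KernPrior r π) {ν : Fin N} {δ : ℝ} (hδ : 0 < δ) (hrt : r ≤ t)
    (hν : r ν + δ ≤ t ν) (z : ∀ ν, Fin (m ν) → ℕ) :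
    HasSum (fun w => logCoeff w * marg t π (z + Pi.single ν w)) (logMarg t π ν z) := by
  have hs : ∀ q ∈ paramSpace m, HasSum
      (fun w => logCoeff w * (kern t q (z + Pi.single ν w) * π q))
      (-Real.log (1 - ∑ i, q ν i) * (kern t q z * π q)) := by
    intro q hq
    refine hasSum_of_eq ((hasSum_logCoeff (hq ν)).mul_right (kern t q z * π q)) fun w => ?_
    rw [kern_add_single hq, monomial]; ring
  have hn : ∀ w, ∀ q ∈ paramSpace m,
      0 ≤ logCoeff w * (kern t q (z + Pi.single ν w) * π q) := fun w q hq =>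
    mul_nonneg (logCoeff_nonneg w) (mul_nonneg (kern_pos hq _ _).le (h.nonneg q hq))
  have hi : ∀ w, IntegrableOn (fun q => logCoeff w * (kern t q (z + Pi.single ν w) * π q))
      (paramSpace m) := fun w => (h.integrableOn_kern hrt _).const_mul _
  have hm := ae_restrict_mem (μ := volume) (measurableSet_paramSpace (m := m))
  have key : HasSum (fun w => ∫ q in paramSpace m,
      logCoeff w * (kern t q (z + Pi.single ν w) * π q)) (logMarg t π ν z) := by
    refine hasSum_integral_of_dominated_convergence
      (fun w q => logCoeff w * (kern t q (z + Pi.single ν w) * π q))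
      (fun w => (hi w).aestronglyMeasurable) (fun w => ?_) ?_ ?_ ?_
    · filter_upwards [hm] with q hq
      rw [Real.norm_of_nonneg (hn w q hq)]
    · filter_upwards [hm] with q hq using (hs q hq).summable
    · refine (h.integrableOn_log hδ hrt hν z).congr ?_
      filter_upwards [hm] with q hq using (hs q hq).tsum_eq.symm
    · filter_upwards [hm] with q hq using hs q hq
  refine hasSum_of_eq key fun w => ?_
  rw [integral_const_mul, marg]

end KernPrior

lemma hasDerivAt_kern {q : ∀ ν, Fin (m ν) → ℝ} (hq : q ∈ paramSpace m) {t : Fin N → ℝ → ℝ}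
    {t' : Fin N → ℝ} {τ : ℝ} (ht : ∀ ν, HasDerivAt (t ν) (t' ν) τ) (z : ∀ ν, Fin (m ν) → ℕ) :
    HasDerivAt (fun τ => kern (fun ν => t ν τ) q z)
      (-∑ ν, t' ν * (-Real.log (1 - ∑ i, q ν i) * kern (fun ν => t ν τ) q z)) τ := by
  have h1 : ∀ t : Fin N → ℝ, kern t q z = Real.exp (∑ ν, (t ν * Real.log (1 - ∑ i, q ν i)
      + ∑ i, z ν i * Real.log (q ν i))) := fun t => by
    rw [← log_kern hq, Real.exp_log (kern_pos hq _ _)]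
  have h2 : HasDerivAt (fun τ => ∑ ν, (t ν τ * Real.log (1 - ∑ i, q ν i)
      + ∑ i, z ν i * Real.log (q ν i))) (∑ ν, t' ν * Real.log (1 - ∑ i, q ν i)) τ :=
    HasDerivAt.fun_sum fun ν _ => ((ht ν).mul_const _).add_const _
  have h3 := h2.exp
  simp only [← h1 (fun ν => t ν _)] at h3
  refine h3.congr_deriv ?_
  rw [Finset.mul_sum, ← Finset.sum_neg_distrib]
  exact Finset.sum_congr rfl fun ν _ => by ring

namespace KernPrior

variable {r : Fin N → ℝ} {π : (∀ ν, Fin (m ν) → ℝ) → ℝ}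

/-- The alternative `hact` avoids the case without a bound: a block either does not move on `U`, or
has spare shape `δ` that makes the logarithm times the kernel at most `1 / δ` times the base kernel.
-/
lemma hasDerivAt_marg (h : KernPrior r π) {t t' : Fin N → ℝ → ℝ} {U : Set ℝ} (hU : IsOpen U)
    (ht : ∀ ν, ∀ τ ∈ U, HasDerivAt (t ν) (t' ν τ) τ) (hrt : ∀ τ ∈ U, r ≤ fun ν => t ν τ)
    {C δ : ℝ} (hδ : 0 < δ) (hC : ∀ ν, ∀ τ ∈ U, |t' ν τ| ≤ C)
    (hact : ∀ ν, (∀ τ ∈ U, t' ν τ = 0) ∨ ∀ τ ∈ U, r ν + δ ≤ t ν τ)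
    (z : ∀ ν, Fin (m ν) → ℕ) {τ : ℝ} (hτ : τ ∈ U) :
    HasDerivAt (fun τ => marg (fun ν => t ν τ) π z)
      (-∑ ν, t' ν τ * logMarg (fun ν => t ν τ) π ν z) τ := by
  have hint : ∀ ν, IntegrableOn (fun q => t' ν τ * (-Real.log (1 - ∑ i, q ν i) *
      (kern (fun ν => t ν τ) q z * π q))) (paramSpace m) := by
    intro ν
    rcases hact ν with h0 | h0
    · simp [h0 τ hτ]
    · exact (h.integrableOn_log hδ (hrt τ hτ) (h0 τ hτ) z).const_mul _
  have key := hasDerivAt_integral_of_dominated_loc_of_deriv_le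
    (μ := volume.restrict (paramSpace m)) (x₀ := τ) (s := U)
    (F := fun τ q => kern (fun ν => t ν τ) q z * π q)
    (F' := fun τ q => -∑ ν, t' ν τ * (-Real.log (1 - ∑ i, q ν i) *
      (kern (fun ν => t ν τ) q z * π q)))
    (bound := fun q => ∑ ν : Fin N, C * (1 / δ * (kern r q 0 * π q)))
    (hU.mem_nhds hτ)
    (by
      filter_upwards [hU.mem_nhds hτ] with σ hσ
      exact (h.integrableOn_kern (hrt σ hσ) z).aestronglyMeasurable)
    (h.integrableOn_kern (hrt τ hτ) z)
    (integrable_finsetSum _ fun ν _ => hint ν).neg.aestronglyMeasurable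
    (by
      filter_upwards [ae_restrict_mem measurableSet_paramSpace] with q hq σ hσ
      rw [norm_neg]
      refine (norm_sum_le _ _).trans (Finset.sum_le_sum fun ν _ => ?_)
      have hk := mul_nonneg (kern_pos hq r 0).le (h.nonneg q hq)
      have hC0 : 0 ≤ C := (abs_nonneg _).trans (hC ν τ hτ)
      rw [norm_mul, Real.norm_of_nonneg (mul_nonneg (neg_log_nonneg hq ν)
        (mul_nonneg (kern_pos hq _ _).le (h.nonneg q hq)))]
      rcases hact ν with h0 | h0
      · rw [h0 σ hσ]; simp; positivity
      · refine mul_le_mul (hC ν σ hσ) ?_ (mul_nonneg (neg_log_nonneg hq ν)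
          (mul_nonneg (kern_pos hq _ _).le (h.nonneg q hq))) hC0
        rw [← mul_assoc, ← mul_assoc]
        exact mul_le_mul_of_nonneg_right (neg_log_mul_kern_le hq hδ (hrt σ hσ) (h0 σ hσ) z)
          (h.nonneg q hq))
    (integrable_finsetSum _ fun ν _ => (h.integrableOn.const_mul _).const_mul _)
    (by
      filter_upwards [ae_restrict_mem measurableSet_paramSpace] with q hq σ hσ
      refine ((hasDerivAt_kern hq (fun ν => ht ν σ hσ) z).mul_const (π q)).congr_deriv ?_
      rw [neg_mul, Finset.sum_mul]
      congr 1
      exact Finset.sum_congr rfl fun ν _ => by ring)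
  refine key.2.congr_deriv ?_
  rw [integral_neg, integral_finsetSum _ fun ν _ => hint ν]
  simp only [integral_const_mul]
  rfl

/-- No logarithm appears, so the base kernel dominates without spare shape, and continuity reaches
down to the initial shapes. -/
lemma continuousOn_marg (h : KernPrior r π) {t : Fin N → ℝ → ℝ} {S : Set ℝ}
    (ht : ∀ ν, ContinuousOn (t ν) S) (hrt : ∀ τ ∈ S, r ≤ fun ν => t ν τ)
    (z : ∀ ν, Fin (m ν) → ℕ) : ContinuousOn (fun τ => marg (fun ν => t ν τ) π z) S := by
  refine continuousOn_of_dominated (bound := fun q => kern r q 0 * π q)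
    (fun τ hτ => (h.integrableOn_kern (hrt τ hτ) z).aestronglyMeasurable) ?_ h.integrableOn ?_
  · intro τ hτ
    filter_upwards [ae_restrict_mem measurableSet_paramSpace] with q hq
    rw [Real.norm_of_nonneg (mul_nonneg (kern_pos hq _ _).le (h.nonneg q hq))]
    exact mul_le_mul_of_nonneg_right (kern_le_kern hq (hrt τ hτ) z) (h.nonneg q hq)
  · filter_upwards [ae_restrict_mem measurableSet_paramSpace] with q hq
    refine ContinuousOn.mul ?_ continuousOn_const
    unfold kern
    exact continuousOn_finsetProd _ fun ν _ => ContinuousOn.mul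
      (ContinuousOn.rpow continuousOn_const (ht ν) fun _ _ => Or.inl (one_sub_pos hq ν).ne')
      continuousOn_const

end KernPrior

end Joint

/-! ### Integrals on countable spaces as sums, and rearrangement of double sums. -/

section Countable

variable {α : Type*} [Countable α] [MeasurableSpace α] [MeasurableSingletonClass α]

lemma eq_withDensity_count {μ : Measure α} {g : α → ℝ} (h : ∀ a, μ {a} = ENNReal.ofReal (g a)) :
    μ = Measure.count.withDensity fun a => ENNReal.ofReal (g a) := by
  rw [Measure.ext_iff_singleton]
  intro a
  rw [withDensity_apply _ (measurableSet_singleton a), h]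
  simp

lemma integrable_iff_summable {μ : Measure α} {g : α → ℝ} (hg : ∀ a, 0 ≤ g a)
    (h : ∀ a, μ {a} = ENNReal.ofReal (g a)) (f : α → ℝ) :
    Integrable f μ ↔ Summable fun a => g a * f a := by
  rw [eq_withDensity_count h, integrable_withDensity_iff_integrable_smul'
    (measurable_of_countable _) (by simp), integrable_count_iff, summable_norm_iff]
  simp [ENNReal.toReal_ofReal (hg _)]

/-- Integrability is not required: without it both sides take the default value `0`. -/
lemma integral_eq_tsum {μ : Measure α} {g : α → ℝ} (hg : ∀ a, 0 ≤ g a)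
    (h : ∀ a, μ {a} = ENNReal.ofReal (g a)) (f : α → ℝ) :
    ∫ a, f a ∂μ = ∑' a, g a * f a := by
  by_cases hf : Integrable f μ
  · rw [integral_countable hf]
    refine tsum_congr fun a => ?_
    rw [measureReal_def, h, ENNReal.toReal_ofReal (hg a), smul_eq_mul]
  · rw [integral_undef hf, tsum_eq_zero_of_not_summable]
    rwa [← integrable_iff_summable hg h]

end Countable

lemma hasSum_prod_of_nonneg {α β : Type*} {f : α × β → ℝ} (hf : ∀ x, 0 ≤ f x) {g : α → ℝ} {a : ℝ}
    (h1 : ∀ x, HasSum (fun y => f (x, y)) (g x)) (h2 : HasSum g a) : HasSum f a := by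
  have hs : Summable f := (summable_prod_of_nonneg hf).2
    ⟨fun x => (h1 x).summable, h2.summable.congr fun x => (h1 x).tsum_eq.symm⟩
  have := hs.hasSum.prod_fiberwise h1
  rw [← this.unique h2]
  exact hs.hasSum

lemma hasSum_mul_prod {α β : Type*} {f : α → ℝ} {g : β → ℝ} {a b : ℝ} (hf : HasSum f a)
    (hg : HasSum g b) : HasSum (fun x : α × β => f x.1 * g x.2) (a * b) := by
  have h := summable_mul_of_summable_norm hf.summable.norm hg.summable.norm
  exact hf.mul hg h

lemma hasSum_swap {α β : Type*} {f : α → β → ℝ} {a : ℝ}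
    (h : HasSum (fun x : β × α => f x.2 x.1) a) : HasSum (fun x : α × β => f x.1 x.2) a :=
  (Equiv.prodComm α β).hasSum_iff.2 h

/-- Summation over pairs `(w, z)` by the value of `z + e w`. -/
lemma hasSum_sum_sub {N : ℕ} {m : Fin N → ℕ} {W : Type*} (e : W → ∀ ν, Fin (m ν) → ℕ)
    (S : (∀ ν, Fin (m ν) → ℕ) → Finset W) (hS : ∀ z w, w ∈ S z ↔ e w ≤ z)
    {f : W × (∀ ν, Fin (m ν) → ℕ) → ℝ} {a : ℝ} (h : HasSum f a) :
    HasSum (fun z => ∑ w ∈ S z, f (w, z - e w)) a := by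
  let E : (Σ z, {w // w ∈ S z}) ≃ W × (∀ ν, Fin (m ν) → ℕ) :=
    { toFun := fun x => (x.2.1, x.1 - e x.2.1)
      invFun := fun y => ⟨y.2 + e y.1, ⟨y.1, (hS _ _).2 le_add_self⟩⟩
      left_inv := by
        rintro ⟨z, w, hw⟩
        have hz : z - e w + e w = z := tsub_add_cancel_of_le ((hS _ _).1 hw)
        simp only [Sigma.mk.injEq]
        refine ⟨hz, ?_⟩
        refine (Subtype.heq_iff_coe_eq fun x => ?_).2 rfl
        simp only [hz]
      right_inv := by
        rintro ⟨w, z⟩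
        simp }
  have h1 := E.hasSum_iff.2 h
  refine HasSum.sigma h1 fun z => ?_
  exact (S z).hasSum fun w => f (w, z - e w)

/-! ### Negative multinomial laws and summability under linear growth. -/

section Joint

variable {N : ℕ} {m : Fin N → ℕ}

lemma mass_nonneg {k : ℕ} {t : ℝ} (ht : 0 < t) {p : Fin k → ℝ} (hp : p ∈ openSimplex k)
    (z : Fin k → ℕ) : 0 ≤ mass t p z := by
  rw [mass_eq ht]
  exact mul_nonneg (coeff_nonneg ht.le z) (mul_nonneg (Real.rpow_nonneg (by linarith [hp.2]) _)
    (Finset.prod_nonneg fun i _ => pow_nonneg (hp.1 i).le _))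

lemma law_singleton {k : ℕ} (t : ℝ) (p : Fin k → ℝ) (z : Fin k → ℕ) :
    law t p {z} = ENNReal.ofReal (mass t p z) := by
  rw [law, withDensity_apply _ (measurableSet_singleton z)]
  simp

instance {k : ℕ} (t : ℝ) (p : Fin k → ℝ) : SigmaFinite (law t p) := by
  unfold law
  exact SigmaFinite.withDensity_ofReal _

lemma isProbabilityMeasure_law {k : ℕ} {t : ℝ} (ht : 0 < t) {p : Fin k → ℝ}
    (hp : p ∈ openSimplex k) : IsProbabilityMeasure (law t p) := by
  constructor
  rw [law, withDensity_apply _ MeasurableSet.univ, setLIntegral_univ, lintegral_count,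
    ← ENNReal.ofReal_tsum_of_nonneg (mass_nonneg ht hp) (hasSum_mass ht hp).summable,
    (hasSum_mass ht hp).tsum_eq, ENNReal.ofReal_one]

lemma jointLaw_singleton {t : Fin N → ℝ} (ht : ∀ ν, 0 < t ν) {p : ∀ ν, Fin (m ν) → ℝ}
    (hp : p ∈ paramSpace m) (z : ∀ ν, Fin (m ν) → ℕ) :
    jointLaw t p {z} = ENNReal.ofReal (jointMass t p z) := by
  rw [jointLaw, Measure.pi_singleton, jointMass,
    ENNReal.ofReal_prod_of_nonneg fun ν _ => mass_nonneg (ht ν) (hp ν) _]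
  simp only [law_singleton]

lemma hasSum_jointMass {t : Fin N → ℝ} (ht : ∀ ν, 0 < t ν) {p : ∀ ν, Fin (m ν) → ℝ}
    (hp : p ∈ paramSpace m) : HasSum (jointMass t p) 1 := by
  have : ∀ ν, IsProbabilityMeasure (law (t ν) (p ν)) := fun ν =>
    isProbabilityMeasure_law (ht ν) (hp ν)
  have hP : IsProbabilityMeasure (jointLaw t p) := by unfold jointLaw; infer_instance
  have h0 := fun z => (jointMass_pos ht hp z).le
  have h1 := (integrable_iff_summable h0 (jointLaw_singleton ht hp) fun _ => (1 : ℝ)).1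
    (integrable_const 1)
  have h2 := integral_eq_tsum h0 (jointLaw_singleton ht hp) fun _ => (1 : ℝ)
  simp only [mul_one, integral_const, probReal_univ, smul_eq_mul] at h1 h2
  rw [h2]; exact h1.hasSum

/-- Coefficients increase with the shape, and the powers of `p₀` are at most one. Dividing by `kern
T p 0` removes those of `T`, giving one summable majorant for all shapes up to `T`. -/
lemma jointMass_le {t T : Fin N → ℝ} (ht : ∀ ν, 0 < t ν) (htT : t ≤ T)
    {p : ∀ ν, Fin (m ν) → ℝ} (hp : p ∈ paramSpace m) (z : ∀ ν, Fin (m ν) → ℕ) :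
    jointMass t p z ≤ jointMass T p z / kern T p (0 : ∀ ν, Fin (m ν) → ℕ) := by
  have hT : ∀ ν, 0 < T ν := fun ν => (ht ν).trans_le (htT ν)
  rw [jointMass_eq ht, jointMass_eq hT, mul_div_assoc]
  have e1 : kern T p z = kern 0 p z * kern T p 0 := by rw [← kern_add hp, zero_add, add_zero]
  have e2 : kern t p z = kern 0 p z * kern t p 0 := by rw [← kern_add hp, zero_add, add_zero]
  rw [e1, mul_div_assoc, div_self (kern_pos hp _ _).ne', mul_one, e2]
  refine mul_le_mul (jointCoeff_mono (fun ν => (ht ν).le) htT z)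
    (mul_le_of_le_one_right (kern_pos hp _ _).le (kern_le_one hp (fun ν => (ht ν).le) 0))
    (mul_nonneg (kern_pos hp _ _).le (kern_pos hp _ _).le) (jointCoeff_pos hT z).le

lemma coeff_add_one {k : ℕ} {t : ℝ} (ht : 0 < t) (z : Fin k → ℕ) :
    coeff (t + 1) z = coeff t z * (1 + (∑ i, (z i : ℝ)) / t) := by
  have h : ∀ n : ℕ, t * ∏ j ∈ Finset.range n, (t + 1 + j) = (∏ j ∈ Finset.range n, (t + j)) * (t + n)
      := by
    intro n
    rw [← Finset.prod_range_succ, Finset.prod_range_succ', mul_comm]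
    simp only [Nat.cast_zero, add_zero]
    congr 1
    exact Finset.prod_congr rfl fun j _ => by push_cast; ring
  have := h (∑ i, z i)
  have hz := (prod_factorial_pos z).ne'
  unfold coeff
  rw [← Nat.cast_sum]
  field_simp
  linarith

lemma one_add_sum_le_prod {ι : Type*} (s : Finset ι) {f : ι → ℝ} (hf : ∀ i, 0 ≤ f i) :
    1 + ∑ i ∈ s, f i ≤ ∏ i ∈ s, (1 + f i) := by
  classical
  induction s using Finset.induction_on with
  | empty => simp
  | insert a s ha ih =>
    rw [Finset.sum_insert ha, Finset.prod_insert ha]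
    nlinarith [hf a, Finset.sum_nonneg fun i (_ : i ∈ s) => hf i]

/-- Raising the shape by one multiplies a coefficient by `1 + |z| / t`, so first moments reduce to
the total mass at shape `t + 1`. -/
lemma one_add_size_mul_jointMass_le {t : Fin N → ℝ} (ht : ∀ ν, 0 < t ν)
    {p : ∀ ν, Fin (m ν) → ℝ} (hp : p ∈ paramSpace m) (z : ∀ ν, Fin (m ν) → ℕ) :
    jointMass t p z * (1 + size z) ≤
      (∏ ν, (1 + t ν)) / kern 1 p (0 : ∀ ν, Fin (m ν) → ℕ) * jointMass (t + 1) p z := by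
  have ht1 : ∀ ν, 0 < (t + 1) ν := fun ν => by simp; linarith [ht ν]
  have hc : jointCoeff (t + 1) z = jointCoeff t z * ∏ ν, (1 + (∑ i, (z ν i : ℝ)) / t ν) := by
    simp only [jointCoeff, ← Finset.prod_mul_distrib]
    exact Finset.prod_congr rfl fun ν _ => coeff_add_one (ht ν) _
  have hk : kern (t + 1) p z = kern t p z * kern 1 p 0 := by rw [← kern_add hp, add_zero]
  have hk0 := kern_pos hp 1 (0 : ∀ ν, Fin (m ν) → ℕ)
  have hs : 1 + size z ≤ (∏ ν, (1 + t ν)) * ∏ ν, (1 + (∑ i, (z ν i : ℝ)) / t ν) := by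
    rw [← Finset.prod_mul_distrib]
    refine (one_add_sum_le_prod _ fun ν => by positivity).trans
      (Finset.prod_le_prod (fun ν _ => by positivity) fun ν _ => ?_)
    have h1 := ht ν
    have h2 : (0 : ℝ) ≤ ∑ i, (z ν i : ℝ) := by positivity
    have h3 : 0 ≤ (∑ i, (z ν i : ℝ)) / t ν := by positivity
    have h4 : t ν * ((∑ i, (z ν i : ℝ)) / t ν) = ∑ i, (z ν i : ℝ) := by field_simp
    nlinarith
  rw [jointMass_eq ht1, hc, hk]
  calc jointMass t p z * (1 + size z)
      ≤ jointMass t p z * ((∏ ν, (1 + t ν)) * ∏ ν, (1 + (∑ i, (z ν i : ℝ)) / t ν)) :=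
        mul_le_mul_of_nonneg_left hs (jointMass_pos ht hp z).le
    _ = _ := by
        rw [jointMass_eq ht]; field_simp

lemma summable_jointMass_mul_size {t : Fin N → ℝ} (ht : ∀ ν, 0 < t ν)
    {p : ∀ ν, Fin (m ν) → ℝ} (hp : p ∈ paramSpace m) :
    Summable fun z : ∀ ν, Fin (m ν) → ℕ => jointMass t p z * (1 + size z) := by
  have ht1 : ∀ ν, 0 < (t + 1) ν := fun ν => by simp; linarith [ht ν]
  exact Summable.of_nonneg_of_le (fun z => mul_nonneg (jointMass_pos ht hp z).le
    (by linarith [size_nonneg z])) (one_add_size_mul_jointMass_le ht hp)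
    ((hasSum_jointMass ht1 hp).summable.mul_left _)

lemma summable_of_linear_growth {t : Fin N → ℝ} (ht : ∀ ν, 0 < t ν)
    {p : ∀ ν, Fin (m ν) → ℝ} (hp : p ∈ paramSpace m) {f : (∀ ν, Fin (m ν) → ℕ) → ℝ} {C : ℝ}
    (hf : ∀ z, |f z| ≤ C * (1 + size z)) : Summable fun z => jointMass t p z * f z := by
  refine Summable.of_norm_bounded ((summable_jointMass_mul_size ht hp).mul_left C) fun z => ?_
  rw [norm_mul, Real.norm_of_nonneg (jointMass_pos ht hp z).le, mul_left_comm]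
  exact mul_le_mul_of_nonneg_left (hf z) (jointMass_pos ht hp z).le

end Joint

/-! ### Derivatives in the shape and the identity with the Stein-type losses. -/

section Joint

variable {N : ℕ} {m : Fin N → ℕ}

lemma jointCoeff_sub_single (t : Fin N → ℝ) (z : ∀ ν, Fin (m ν) → ℕ) (ν : Fin N)
    (w : Fin (m ν) → ℕ) : jointCoeff t (z - Pi.single ν w) =
      (∏ j ∈ Finset.univ.erase ν, coeff (t j) (z j)) * coeff (t ν) (z ν - w) := by
  rw [jointCoeff, ← Finset.mul_prod_erase _ _ (Finset.mem_univ ν), mul_comm]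
  congr 1
  · refine Finset.prod_congr rfl fun j hj => ?_
    simp [Pi.single_eq_of_ne (Finset.ne_of_mem_erase hj)]
  · simp

lemma single_le_iff {z : ∀ ν, Fin (m ν) → ℕ} {ν : Fin N} {w : Fin (m ν) → ℕ} :
    Pi.single ν w ≤ z ↔ w ≤ z ν := by
  constructor
  · intro h; simpa using h ν
  · intro h j
    by_cases hj : j = ν
    · subst hj; simpa using h
    · simp [Pi.single_eq_of_ne hj]

lemma hasDerivAt_jointCoeff {t : Fin N → ℝ → ℝ} {t' : Fin N → ℝ} {τ : ℝ}
    (ht : ∀ ν, HasDerivAt (t ν) (t' ν) τ) (z : ∀ ν, Fin (m ν) → ℕ) :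
    HasDerivAt (fun τ => jointCoeff (fun ν => t ν τ) z)
      (∑ ν, t' ν * ∑ w ∈ Finset.Iic (z ν),
        logCoeff w * jointCoeff (fun ν => t ν τ) (z - Pi.single ν w)) τ := by
  have h := HasDerivAt.fun_finsetProd (u := Finset.univ) (f := fun ν τ => coeff (t ν τ) (z ν))
    (x := τ) fun ν _ => (hasDerivAt_coeff (t ν τ) (z ν)).comp τ (ht ν)
  refine h.congr_deriv (Finset.sum_congr rfl fun ν _ => ?_)
  simp only [jointCoeff_sub_single, smul_eq_mul, Finset.mul_sum, Finset.sum_mul]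
  exact Finset.sum_congr rfl fun w _ => by ring

lemma sum_logCoeff_mul_jointCoeff_le {t T : Fin N → ℝ} (ht : ∀ ν, 0 < t ν) (htT : t ≤ T)
    (z : ∀ ν, Fin (m ν) → ℕ) (ν : Fin N) :
    ∑ w ∈ Finset.Iic (z ν), logCoeff w * jointCoeff t (z - Pi.single ν w) ≤
      jointCoeff (T + 1) z := by
  have h0 : ∀ j, 0 ≤ coeff (t j) (z j) := fun j => coeff_nonneg (ht j).le _
  have h1 : ∀ j, coeff (t j) (z j) ≤ coeff ((T + 1) j) (z j) := fun j =>
    coeff_mono (ht j).le ((htT j).trans (by simp)) _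
  calc ∑ w ∈ Finset.Iic (z ν), logCoeff w * jointCoeff t (z - Pi.single ν w)
      = (∑ w ∈ Finset.Iic (z ν), logCoeff w * coeff (t ν) (z ν - w)) *
        ∏ j ∈ Finset.univ.erase ν, coeff (t j) (z j) := by
        rw [Finset.sum_mul]
        exact Finset.sum_congr rfl fun w _ => by rw [jointCoeff_sub_single]; ring
    _ ≤ coeff ((T + 1) ν) (z ν) * ∏ j ∈ Finset.univ.erase ν, coeff ((T + 1) j) (z j) := by
        refine mul_le_mul ((sum_logCoeff_mul_coeff_le (ht ν).le _).trans
          (coeff_mono (by linarith [ht ν]) (by simpa using htT ν) _))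
          (Finset.prod_le_prod (fun j _ => h0 j) fun j _ => h1 j)
          (Finset.prod_nonneg fun j _ => h0 j) ((h0 ν).trans (h1 ν))
    _ = _ := by
        rw [jointCoeff, Finset.mul_prod_erase Finset.univ (fun j => coeff ((T + 1) j) (z j))
          (Finset.mem_univ ν)]

/-- The convolution of the joint mass function with the Lévy measure of block `ν`. -/
noncomputable def levyConv (t : Fin N → ℝ) (p : ∀ ν, Fin (m ν) → ℝ) (ν : Fin N)
    (z : ∀ ν, Fin (m ν) → ℕ) : ℝ :=
  ∑ w ∈ Finset.Iic (z ν), logCoeff w * monomial ν w p * jointMass t p (z - Pi.single ν w)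

/-- The derivative of the joint mass function in the shape of block `ν`. -/
noncomputable def massDeriv (t : Fin N → ℝ) (p : ∀ ν, Fin (m ν) → ℝ) (ν : Fin N)
    (z : ∀ ν, Fin (m ν) → ℕ) : ℝ :=
  Real.log (1 - ∑ i, p ν i) * jointMass t p z + levyConv t p ν z

lemma levyConv_eq {t : Fin N → ℝ} (ht : ∀ ν, 0 < t ν) {p : ∀ ν, Fin (m ν) → ℝ}
    (hp : p ∈ paramSpace m) (ν : Fin N) (z : ∀ ν, Fin (m ν) → ℕ) :
    levyConv t p ν z = (∑ w ∈ Finset.Iic (z ν),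
      logCoeff w * jointCoeff t (z - Pi.single ν w)) * kern t p z := by
  rw [levyConv, Finset.sum_mul]
  refine Finset.sum_congr rfl fun w hw => ?_
  have : kern t p z = monomial ν w p * kern t p (z - Pi.single ν w) := by
    rw [← kern_add_single hp, tsub_add_cancel_of_le (single_le_iff.2 (Finset.mem_Iic.1 hw))]
  rw [this, jointMass_eq ht]; ring

lemma hasDerivAt_jointMass {t t' : Fin N → ℝ → ℝ} {U : Set ℝ} (hU : IsOpen U)
    (ht : ∀ ν, ∀ τ ∈ U, HasDerivAt (t ν) (t' ν τ) τ) (ht0 : ∀ ν, ∀ τ ∈ U, 0 < t ν τ)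
    {p : ∀ ν, Fin (m ν) → ℝ} (hp : p ∈ paramSpace m) (z : ∀ ν, Fin (m ν) → ℕ) {τ : ℝ}
    (hτ : τ ∈ U) : HasDerivAt (fun τ => jointMass (fun ν => t ν τ) p z)
      (∑ ν, t' ν τ * massDeriv (fun ν => t ν τ) p ν z) τ := by
  have h := (hasDerivAt_jointCoeff (fun ν => ht ν τ hτ) z).mul
    (hasDerivAt_kern hp (fun ν => ht ν τ hτ) z)
  have he : (fun τ => jointMass (fun ν => t ν τ) p z) =ᶠ[nhds τ]
      (fun τ => jointCoeff (fun ν => t ν τ) z) * fun τ => kern (fun ν => t ν τ) p z := by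
    filter_upwards [hU.mem_nhds hτ] with σ hσ
    exact jointMass_eq (fun ν => ht0 ν σ hσ) p z
  refine (h.congr_of_eventuallyEq he).congr_deriv ?_
  rw [Finset.sum_mul, ← Finset.sum_neg_distrib, Finset.mul_sum, ← Finset.sum_add_distrib]
  refine Finset.sum_congr rfl fun ν _ => ?_
  rw [massDeriv, levyConv_eq (fun ν => ht0 ν τ hτ) hp, jointMass_eq fun ν => ht0 ν τ hτ]
  ring

lemma abs_massDeriv_le {t T : Fin N → ℝ} (ht : ∀ ν, 0 < t ν) (htT : t ≤ T)
    {p : ∀ ν, Fin (m ν) → ℝ} (hp : p ∈ paramSpace m) (ν : Fin N) (z : ∀ ν, Fin (m ν) → ℕ) :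
    |massDeriv t p ν z| ≤ (|Real.log (1 - ∑ i, p ν i)| + 1) /
      kern (T + 1) p (0 : ∀ ν, Fin (m ν) → ℕ) * jointMass (T + 1) p z := by
  have htT1 : t ≤ T + 1 := htT.trans fun j => by simp
  have hT1 : ∀ ν, 0 < (T + 1) ν := fun j => (ht j).trans_le (htT1 j)
  have e1 := jointMass_le ht htT1 hp z
  have hk0 := kern_pos hp (T + 1) (0 : ∀ ν, Fin (m ν) → ℕ)
  have e2 : levyConv t p ν z ≤ jointMass (T + 1) p z / kern (T + 1) p 0 := by
    rw [levyConv_eq ht hp, jointMass_eq hT1, mul_div_assoc]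
    refine mul_le_mul (sum_logCoeff_mul_jointCoeff_le ht htT z ν) ?_ (kern_pos hp _ _).le
      (jointCoeff_pos hT1 z).le
    rw [le_div_iff₀ hk0, ← kern_add hp, add_zero, add_comm]
    have := kern_add hp (T + 1) t z 0
    rw [add_zero] at this
    rw [this]
    exact mul_le_of_le_one_right (kern_pos hp _ _).le (kern_le_one hp (fun j => (ht j).le) 0)
  have e3 : 0 ≤ levyConv t p ν z := Finset.sum_nonneg fun w _ => mul_nonneg
    (mul_nonneg (logCoeff_nonneg w) (Finset.prod_nonneg fun i _ => pow_nonneg ((hp ν).1 i).le _))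
    (jointMass_pos ht hp _).le
  rw [massDeriv]
  refine (abs_add_le _ _).trans ?_
  rw [abs_mul, abs_of_nonneg e3, abs_of_nonneg (jointMass_pos ht hp z).le]
  have := mul_le_mul_of_nonneg_left e1 (abs_nonneg (Real.log (1 - ∑ i, p ν i)))
  calc _ ≤ _ := add_le_add this e2
    _ = _ := by ring

/-- The likelihood score difference in the shape of block `ν`. -/
noncomputable def scoreDiff (t : Fin N → ℝ) (π : (∀ ν, Fin (m ν) → ℝ) → ℝ)
    (p : ∀ ν, Fin (m ν) → ℝ) (ν : Fin N) (z : ∀ ν, Fin (m ν) → ℕ) : ℝ :=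
  Real.log (1 - ∑ i, p ν i) + logMarg t π ν z / marg t π z

/-- The summand of the derivative of the expected `logLik` in the shape of block `ν`. -/
noncomputable def derivTerm (t : Fin N → ℝ) (π : (∀ ν, Fin (m ν) → ℝ) → ℝ)
    (p : ∀ ν, Fin (m ν) → ℝ) (ν : Fin N) (z : ∀ ν, Fin (m ν) → ℕ) : ℝ :=
  massDeriv t p ν z * logLik t π p z + jointMass t p z * scoreDiff t π p ν z

lemma postMean_eq {t : Fin N → ℝ} (ht : ∀ ν, 0 < t ν) (π h : (∀ ν, Fin (m ν) → ℝ) → ℝ)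
    (z : ∀ ν, Fin (m ν) → ℕ) :
    postMean t π h z = (∫ q in paramSpace m, h q * (kern t q z * π q)) / marg t π z := by
  have e : ∀ q, h q * (jointMass t q z * π q) = jointCoeff t z * (h q * (kern t q z * π q)) :=
    fun q => by rw [jointMass_eq ht]; ring
  rw [postMean]
  simp only [e]
  simp only [jointMass_eq ht, mul_assoc (jointCoeff t z), integral_const_mul]
  rw [mul_div_mul_left _ _ (jointCoeff_pos ht z).ne']
  rfl

/-- A monomial times the kernel is the kernel of a shifted observation with the same shape. -/
lemma postMean_monomial {t : Fin N → ℝ} (ht : ∀ ν, 0 < t ν) (π : (∀ ν, Fin (m ν) → ℝ) → ℝ)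
    (ν : Fin N) (w : Fin (m ν) → ℕ) (z : ∀ ν, Fin (m ν) → ℕ) :
    postMean t π (monomial ν w) z = marg t π (z + Pi.single ν w) / marg t π z := by
  rw [postMean_eq ht]
  congr 1
  refine setIntegral_congr_fun measurableSet_paramSpace fun q hq => ?_
  simp only [kern_add_single hq]; ring

lemma monomial_pos {p : ∀ ν, Fin (m ν) → ℝ} (hp : p ∈ paramSpace m) (ν : Fin N)
    (w : Fin (m ν) → ℕ) : 0 < monomial ν w p :=
  Finset.prod_pos fun i _ => pow_pos ((hp ν).1 i) _

lemma monomial_le_one {p : ∀ ν, Fin (m ν) → ℝ} (hp : p ∈ paramSpace m) (ν : Fin N)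
    (w : Fin (m ν) → ℕ) : monomial ν w p ≤ 1 :=
  Finset.prod_le_one (fun i _ => pow_nonneg ((hp ν).1 i).le _)
    fun i _ => pow_le_one₀ ((hp ν).1 i).le (le_one_of_mem hp ν i)

lemma lossKL_nonneg {d θ : ℝ} (hd : 0 < d) (hθ : 0 < θ) : 0 ≤ lossKL d θ := by
  have h := mul_le_mul_of_nonneg_left (Real.log_le_sub_one_of_pos (div_pos hd hθ)) hθ.le
  have : θ * (d / θ - 1) = d - θ := by field_simp
  rw [lossKL]; linarith

/-- The factor `1 / k` in the Lévy weight cancels the degree, leaving the geometric-type series of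
`coeff 1`. -/
lemma summable_levy_mul_size {p : ∀ ν, Fin (m ν) → ℝ} (hp : p ∈ paramSpace m) (ν : Fin N) :
    Summable fun w : Fin (m ν) → ℕ =>
      logCoeff w * monomial ν w p * (1 + ∑ i, (w i : ℝ)) := by
  have h1 := ((hasSum_coeff (t := 1) zero_le_one (hp ν)).summable).mul_left 2
  have hθ0 : ∀ w, 0 ≤ monomial ν w p := fun w => (monomial_pos hp ν w).le
  refine h1.of_nonneg_of_le (fun w => mul_nonneg (mul_nonneg (logCoeff_nonneg w) (hθ0 w))
    (by positivity)) fun w => ?_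
  have e1 := logCoeff_le_coeff_one w
  have e2 : logCoeff w * ∑ i, (w i : ℝ) ≤ coeff 1 w := by
    rw [← Nat.cast_sum]
    have hf : coeff 1 w = ((∑ i, w i)! : ℝ) / ∏ i, ((w i)! : ℝ) := by
      rw [coeff, ← Finset.prod_range_add_one_eq_factorial]; push_cast
      simp only [add_comm]
    rw [hf, logCoeff]
    have hpos : (0 : ℝ) ≤ ((∑ i, w i)! : ℝ) / ∏ i, ((w i)! : ℝ) := by positivity
    rcases Nat.eq_zero_or_pos (∑ i, w i) with h0 | h0
    · rw [h0] at hpos ⊢; simpa using hpos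
    · have : ((∑ i, w i : ℕ) : ℝ) ≠ 0 := by exact_mod_cast h0.ne'
      refine le_of_eq ?_
      field_simp
  have := mul_le_mul_of_nonneg_right (add_le_add e1 e2) (hθ0 w)
  change logCoeff w * monomial ν w p * (1 + ∑ i, (w i : ℝ)) ≤ 2 * (coeff 1 w * monomial ν w p)
  linarith

namespace KernPrior

variable {r t : Fin N → ℝ} {π : (∀ ν, Fin (m ν) → ℝ) → ℝ}

lemma monomialLoss_nonneg (h : KernPrior r π) (ht : ∀ ν, 0 < t ν) (hrt : r ≤ t)
    {p : ∀ ν, Fin (m ν) → ℝ} (hp : p ∈ paramSpace m) (ν : Fin N) (w : Fin (m ν) → ℕ)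
    (z : ∀ ν, Fin (m ν) → ℕ) : 0 ≤ monomialLoss t π p ν w z := by
  rw [monomialLoss, postMean_monomial ht]
  exact lossKL_nonneg (div_pos (h.marg_pos_of_le hrt _) (h.marg_pos_of_le hrt _))
    (monomial_pos hp ν w)

lemma monomialLoss_eq (h : KernPrior r π) (ht : ∀ ν, 0 < t ν) (hrt : r ≤ t)
    {p : ∀ ν, Fin (m ν) → ℝ} (hp : p ∈ paramSpace m) (ν : Fin N) (w : Fin (m ν) → ℕ)
    (z : ∀ ν, Fin (m ν) → ℕ) : monomialLoss t π p ν w z =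
      marg t π (z + Pi.single ν w) / marg t π z - monomial ν w p
        + monomial ν w p * logLik t π p (z + Pi.single ν w)
        - monomial ν w p * logLik t π p z := by
  have h1 := (h.marg_pos_of_le hrt z).ne'
  have h2 := (h.marg_pos_of_le hrt (z + Pi.single ν w)).ne'
  have h3 := (monomial_pos hp ν w).ne'
  rw [monomialLoss, postMean_monomial ht, lossKL, logLik, logLik, kern_add_single hp,
    Real.log_mul h3 (kern_pos hp t z).ne', Real.log_div (div_ne_zero h2 h1) h3,
    Real.log_div h2 h1]
  ring

lemma marg_add_single_le (h : KernPrior r π) (hrt : r ≤ t) (ν : Fin N) (w : Fin (m ν) → ℕ)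
    (z : ∀ ν, Fin (m ν) → ℕ) : marg t π (z + Pi.single ν w) ≤ marg t π z :=
  setIntegral_mono_on (h.integrableOn_kern hrt _) (h.integrableOn_kern hrt z)
    measurableSet_paramSpace fun q hq => mul_le_mul_of_nonneg_right
      ((kern_add_single hq t z ν w).trans_le
        (mul_le_of_le_one_left (kern_pos hq _ _).le (monomial_le_one hq ν w))) (h.nonneg q hq)

lemma integrable_monomialLoss (h : KernPrior r π) (hr : 0 ≤ r) (ht : ∀ ν, 0 < t ν)
    (hrt : r ≤ t) {p : ∀ ν, Fin (m ν) → ℝ} (hp : p ∈ paramSpace m) (ν : Fin N)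
    (w : Fin (m ν) → ℕ) : Integrable (monomialLoss t π p ν w) (jointLaw t p) := by
  obtain ⟨C, hC0, hC⟩ := h.exists_log_bound hr hp t
  rw [integrable_iff_summable (fun z => (jointMass_pos ht hp z).le) (jointLaw_singleton ht hp)]
  refine summable_of_linear_growth ht hp
    (C := 1 + C * (1 + size (Pi.single ν w : ∀ ν, Fin (m ν) → ℕ)) + C) fun z => ?_
  rw [abs_of_nonneg (h.monomialLoss_nonneg ht hrt hp ν w z), h.monomialLoss_eq ht hrt hp]
  have a1 : marg t π (z + Pi.single ν w) / marg t π z ≤ 1 :=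
    div_le_one_of_le₀ (h.marg_add_single_le hrt ν w z) (h.marg_pos_of_le hrt z).le
  have a2 := (monomial_pos hp ν w)
  have a3 : ∀ z, |monomial ν w p * logLik t π p z| ≤ C * (1 + size z) := fun z => by
    rw [abs_mul, abs_of_pos a2]
    exact (mul_le_of_le_one_left (abs_nonneg _) (monomial_le_one hp ν w)).trans (hC t hrt le_rfl z).2
  have a4 := (le_abs_self _).trans (a3 (z + Pi.single ν w))
  have a5 := (neg_abs_le _).trans' (neg_le_neg (a3 z))
  rw [size_add] at a4
  have s1 := size_nonneg z
  have s2 := size_nonneg (Pi.single ν w : ∀ ν, Fin (m ν) → ℕ)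
  set s := size (Pi.single ν w : ∀ ν, Fin (m ν) → ℕ)
  have : C * (1 + (size z + s)) ≤ C * (1 + s) * (1 + size z) := by
    nlinarith [mul_nonneg hC0 (mul_nonneg s1 s2)]
  nlinarith

lemma exists_logMarg_bound (h : KernPrior r π) (hr : 0 ≤ r) {p : ∀ ν, Fin (m ν) → ℝ}
    (hp : p ∈ paramSpace m) (T : Fin N → ℝ) {δ : ℝ} (hδ : 0 < δ) :
    ∃ C : ℝ, ∀ t, r ≤ t → t ≤ T → ∀ ν, r ν + δ ≤ t ν → ∀ z : ∀ ν, Fin (m ν) → ℕ,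
      |logMarg t π ν z / marg t π z| ≤ C * (1 + size z) := by
  obtain ⟨C, hC0, hC⟩ := h.exists_log_bound hr hp T
  refine ⟨1 / δ * (C + C), fun t hrt htT ν hν z => ?_⟩
  have hmp := h.marg_pos_of_le hrt z
  rw [abs_of_nonneg (div_nonneg (h.logMarg_nonneg t ν z) hmp.le), div_le_iff₀' hmp]
  refine (h.logMarg_le hδ hrt hν z).trans ?_
  refine mul_le_mul_of_nonneg_left ?_ hmp.le
  rw [mul_assoc]
  refine mul_le_mul_of_nonneg_left ?_ (by positivity)
  have b1 := (hC t hrt htT z).1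
  have b2 := (hC (t - Pi.single ν δ) (le_sub_single hrt hν)
    ((sub_le_self t (Pi.single_nonneg.2 hδ.le)).trans htT) z).1
  linarith [neg_abs_le (Real.log (marg t π z)),
    le_abs_self (Real.log (marg (t - Pi.single ν δ) π z))]

lemma summable_logMarg_div_marg (h : KernPrior r π) (hr : 0 ≤ r) (ht : ∀ ν, 0 < t ν) (hrt : r ≤ t)
    {p : ∀ ν, Fin (m ν) → ℝ} (hp : p ∈ paramSpace m) {ν : Fin N} {δ : ℝ} (hδ : 0 < δ)
    (hν : r ν + δ ≤ t ν) :
    Summable fun z => jointMass t p z * (logMarg t π ν z / marg t π z) := by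
  obtain ⟨C, hC⟩ := h.exists_logMarg_bound hr hp t hδ
  exact summable_of_linear_growth ht hp fun z => hC t hrt le_rfl ν hν z

lemma hasSum_marg_add_single_div_marg (h : KernPrior r π) (hr : 0 ≤ r) (ht : ∀ ν, 0 < t ν)
    (hrt : r ≤ t) {p : ∀ ν, Fin (m ν) → ℝ} (hp : p ∈ paramSpace m) {ν : Fin N} {δ : ℝ}
    (hδ : 0 < δ) (hν : r ν + δ ≤ t ν) :
    HasSum (fun x : (Fin (m ν) → ℕ) × (∀ ν, Fin (m ν) → ℕ) =>
      logCoeff x.1 * jointMass t p x.2 * (marg t π (x.2 + Pi.single ν x.1) / marg t π x.2))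
      (∑' z, jointMass t p z * (logMarg t π ν z / marg t π z)) := by
  have hmp := fun z => h.marg_pos_of_le hrt z
  set f : (Fin (m ν) → ℕ) → (∀ ν, Fin (m ν) → ℕ) → ℝ := fun w z =>
    logCoeff w * jointMass t p z * (marg t π (z + Pi.single ν w) / marg t π z) with hf
  have key : HasSum (fun x : (∀ ν, Fin (m ν) → ℕ) × (Fin (m ν) → ℕ) => f x.2 x.1)
      (∑' z, jointMass t p z * (logMarg t π ν z / marg t π z)) := by
    have hn : ∀ w z, 0 ≤ f w z := fun w z => mul_nonneg (mul_nonneg (logCoeff_nonneg _)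
      (jointMass_pos ht hp _).le) (div_nonneg (hmp _).le (hmp _).le)
    refine hasSum_prod_of_nonneg (fun x => hn _ _) (fun z => ?_)
      (h.summable_logMarg_div_marg hr ht hrt hp hδ hν).hasSum
    have h1 := ((h.hasSum_marg_add_single hδ hrt hν z).div_const (marg t π z)).mul_left
      (jointMass t p z)
    refine hasSum_of_eq h1 fun w => ?_
    simp only [hf]
    rw [mul_comm (logCoeff w), mul_assoc, mul_div_assoc]
  exact hasSum_swap key

lemma summable_levy_mul_logLik (h : KernPrior r π) (hr : 0 ≤ r) (ht : ∀ ν, 0 < t ν)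
    (hrt : r ≤ t) {p : ∀ ν, Fin (m ν) → ℝ} (hp : p ∈ paramSpace m) (ν : Fin N) :
    Summable (fun x : (Fin (m ν) → ℕ) × (∀ ν, Fin (m ν) → ℕ) =>
      logCoeff x.1 * monomial ν x.1 p * jointMass t p x.2 *
        logLik t π p (x.2 + Pi.single ν x.1)) := by
  obtain ⟨C, hC0, hC⟩ := h.exists_log_bound hr hp t
  have hb := (summable_mul_of_summable_norm (summable_levy_mul_size hp ν).norm
    (summable_jointMass_mul_size ht hp).norm).mul_left C
  refine Summable.of_norm_bounded hb fun x => ?_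
  obtain ⟨w, z⟩ := x
  have hnn : 0 ≤ logCoeff w * monomial ν w p * jointMass t p z :=
    mul_nonneg (mul_nonneg (logCoeff_nonneg w) (monomial_pos hp ν w).le) (jointMass_pos ht hp z).le
  rw [norm_mul, Real.norm_of_nonneg hnn]
  have h1 := (hC t hrt le_rfl (z + Pi.single ν w)).2
  rw [size_add, size_single] at h1
  have h2 : C * (1 + (size z + ∑ i, (w i : ℝ))) ≤
      C * ((1 + ∑ i, (w i : ℝ)) * (1 + size z)) := by
    refine mul_le_mul_of_nonneg_left ?_ hC0
    have := size_nonneg z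
    have : (0 : ℝ) ≤ ∑ i, (w i : ℝ) := by positivity
    nlinarith
  refine (mul_le_mul_of_nonneg_left (h1.trans h2) hnn).trans (le_of_eq ?_)
  ring

lemma hasSum_levyConv_mul_logLik (h : KernPrior r π) (hr : 0 ≤ r) (ht : ∀ ν, 0 < t ν)
    (hrt : r ≤ t) {p : ∀ ν, Fin (m ν) → ℝ} (hp : p ∈ paramSpace m) (ν : Fin N) :
    HasSum (fun z => levyConv t p ν z * logLik t π p z) (∑'
      x : (Fin (m ν) → ℕ) × (∀ ν, Fin (m ν) → ℕ), logCoeff x.1 * monomial ν x.1 p *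
        jointMass t p x.2 * logLik t π p (x.2 + Pi.single ν x.1)) := by
  refine hasSum_of_eq (hasSum_sum_sub (fun w => Pi.single ν w) (fun z => Finset.Iic (z ν))
    (fun z w => by rw [Finset.mem_Iic, single_le_iff])
    (h.summable_levy_mul_logLik hr ht hrt hp ν).hasSum) fun z => ?_
  rw [levyConv, Finset.sum_mul]
  refine Finset.sum_congr rfl fun w hw => ?_
  rw [tsub_add_cancel_of_le (single_le_iff.2 (Finset.mem_Iic.1 hw))]

/-- The core identity. Each side splits into four absolutely convergent pieces: the posterior mean
of `-log p₀`, its true value `Λ`, the Lévy convolution against `logLik`, and `Λ` times the mean of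
`logLik`. They match by the Lévy expansion of `-log p₀` and by reindexing `z` as `z + w`. -/
lemma hasSum_derivTerm (h : KernPrior r π) (hr : 0 ≤ r) (ht : ∀ ν, 0 < t ν) (hrt : r ≤ t)
    {p : ∀ ν, Fin (m ν) → ℝ} (hp : p ∈ paramSpace m) {ν : Fin N} {δ : ℝ} (hδ : 0 < δ)
    (hν : r ν + δ ≤ t ν) :
    ∃ a, HasSum (derivTerm t π p ν) a ∧
    HasSum (fun x : (Fin (m ν) → ℕ) × (∀ ν, Fin (m ν) → ℕ) =>
      logCoeff x.1 * (jointMass t p x.2 * monomialLoss t π p ν x.1 x.2)) a := by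
  obtain ⟨C, hC0, hC⟩ := h.exists_log_bound hr hp t
  have hJ := hasSum_jointMass ht hp
  set Λ : ℝ := -Real.log (1 - ∑ i, p ν i) with hΛ
  have hc : HasSum (fun w => logCoeff w * monomial ν w p) Λ := hasSum_logCoeff (hp ν)
  have s1 := (h.summable_logMarg_div_marg hr ht hrt hp hδ hν).hasSum
  have p1 := h.hasSum_marg_add_single_div_marg hr ht hrt hp hδ hν
  have p2 := hasSum_mul_prod hc hJ
  have sJ : Summable fun z => jointMass t p z * logLik t π p z :=
    summable_of_linear_growth ht hp fun z => (hC t hrt le_rfl z).2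
  have p4 := hasSum_mul_prod hc sJ.hasSum
  have s3 := (h.summable_levy_mul_logLik hr ht hrt hp ν).hasSum
  have p3 := h.hasSum_levyConv_mul_logLik hr ht hrt hp ν
  -- `hD` sums over `z` and `hL` over pairs `(w, z)`, with the same value for each of the four
  -- pieces.
  have hD := ((s1.sub (hJ.mul_left Λ)).add p3).sub (sJ.hasSum.mul_left Λ)
  have hL := ((p1.sub p2).add s3).sub p4
  have eD : ∀ z, derivTerm t π p ν z = jointMass t p z * (logMarg t π ν z / marg t π z)
      - Λ * jointMass t p z + levyConv t p ν z * logLik t π p z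
      - Λ * (jointMass t p z * logLik t π p z) := fun z => by
    rw [derivTerm, massDeriv, scoreDiff]
    ring
  refine ⟨_, hasSum_of_eq hD eD, ?_⟩
  refine hasSum_of_eq hL ?_
  rintro ⟨w, z⟩
  rw [h.monomialLoss_eq ht hrt hp]
  ring

lemma hasSum_degreeTerm (h : KernPrior r π) (hr : 0 ≤ r) (ht : ∀ ν, 0 < t ν) (hrt : r ≤ t)
    {p : ∀ ν, Fin (m ν) → ℝ} (hp : p ∈ paramSpace m) {ν : Fin N} {δ : ℝ} (hδ : 0 < δ)
    (hν : r ν + δ ≤ t ν) :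
    ∃ a, HasSum (derivTerm t π p ν) a ∧
      HasSum (fun k : ℕ => degreeTerm t π p ν (k + 1)) a := by
  obtain ⟨a, hD, hL⟩ := h.hasSum_derivTerm hr ht hrt hp hδ hν
  refine ⟨a, hD, ?_⟩
  have hJ0 : ∀ z, 0 ≤ jointMass t p z := fun z => (jointMass_pos ht hp z).le
  have hI : ∀ w, HasSum (fun z => logCoeff w * (jointMass t p z * monomialLoss t π p ν w z))
      (logCoeff w * ∫ z, monomialLoss t π p ν w z ∂(jointLaw t p)) := by
    intro w
    rw [integral_eq_tsum hJ0 (jointLaw_singleton ht hp)]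
    exact ((integrable_iff_summable hJ0 (jointLaw_singleton ht hp) _).1
      (h.integrable_monomialLoss hr ht hrt hp ν w)).hasSum.mul_left _
  have hW := hL.prod_fiberwise hI
  rw [hasSum_iff_hasSum_piAntidiag fun w => mul_nonneg (logCoeff_nonneg w)
    (integral_nonneg (h.monomialLoss_nonneg ht hrt hp ν w))] at hW
  have hk : ∀ k, degreeTerm t π p ν k =
      ∑ w ∈ Finset.piAntidiag (Finset.univ : Finset (Fin (m ν))) k,
        logCoeff w * ∫ z, monomialLoss t π p ν w z ∂(jointLaw t p) := by
    intro k
    rw [degreeTerm, Finset.mul_sum]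
    refine Finset.sum_congr rfl fun w hw => ?_
    have hw : ∑ i, w i = k := by simpa using hw
    rw [logCoeff, hw, mul_assoc]
  have h1 := (hasSum_nat_add_iff' 1).2 (hasSum_of_eq hW hk)
  have h0 : degreeTerm t π p ν 0 = 0 := by simp [degreeTerm]
  rw [Finset.sum_range_one, h0, sub_zero] at h1
  exact h1

lemma degreeTerm_nonneg (h : KernPrior r π) (ht : ∀ ν, 0 < t ν) (hrt : r ≤ t)
    {p : ∀ ν, Fin (m ν) → ℝ} (hp : p ∈ paramSpace m) (ν : Fin N) (k : ℕ) :
    0 ≤ degreeTerm t π p ν k :=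
  mul_nonneg (by positivity) (Finset.sum_nonneg fun w _ => mul_nonneg
    (by positivity) (integral_nonneg (h.monomialLoss_nonneg ht hrt hp ν w)))

end KernPrior

end Joint

/-! ### Integrability of a derivative off a finite set, and monotone paths near their initial value.
-/

section Calculus

/-- A nonnegative derivative of a continuous function is integrable; cut the interval at the
exceptional points. -/
lemma intervalIntegrable_of_hasDerivAt_off_finite {F g : ℝ → ℝ} (S : Finset ℝ) {a b : ℝ}
    (hab : a ≤ b) (hF : ContinuousOn F (Icc a b)) (hg : ∀ x ∈ Ioo a b, 0 ≤ g x)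
    (hd : ∀ x ∈ Ioo a b, x ∉ S → HasDerivAt F (g x) x) : IntervalIntegrable g volume a b := by
  induction S using Finset.induction_on generalizing a b with
  | empty =>
    apply intervalIntegral.intervalIntegrable_deriv_of_nonneg (g := F)
    · rwa [uIcc_of_le hab]
    · rw [min_eq_left hab, max_eq_right hab]
      exact fun x hx => hd x hx (by simp)
    · rwa [min_eq_left hab, max_eq_right hab]
  | insert c S hc ih =>
    by_cases hcab : c ∈ Ioo a b
    · have h1 := ih hcab.1.le (hF.mono (Icc_subset_Icc_right hcab.2.le))
        (fun x hx => hg x ⟨hx.1, hx.2.trans hcab.2⟩)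
        (fun x hx hxS => hd x ⟨hx.1, hx.2.trans hcab.2⟩ (by
          simp only [Finset.mem_insert, not_or]; exact ⟨hx.2.ne, hxS⟩))
      have h2 := ih hcab.2.le (hF.mono (Icc_subset_Icc_left hcab.1.le))
        (fun x hx => hg x ⟨hcab.1.trans hx.1, hx.2⟩)
        (fun x hx hxS => hd x ⟨hcab.1.trans hx.1, hx.2⟩ (by
          simp only [Finset.mem_insert, not_or]; exact ⟨hx.1.ne', hxS⟩))
      exact h1.trans h2
    · refine ih hab hF hg fun x hx hxS => hd x hx ?_
      simp only [Finset.mem_insert, not_or]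
      exact ⟨fun h => hcab (h ▸ hx), hxS⟩

/-- A monotone function on `[0, 1]` has derivative `0` wherever it still has its initial value. -/
lemma derivWithin_eq_zero_of_eq {t : ℝ → ℝ} (hd : DifferentiableOn ℝ t (Icc 0 1))
    (hm : MonotoneOn t (Icc 0 1)) {τ : ℝ} (hτ : τ ∈ Ioc (0 : ℝ) 1) (h : t τ = t 0) :
    derivWithin t (Icc 0 1) τ = 0 := by
  have hτ' : τ ∈ Icc (0 : ℝ) 1 := ⟨hτ.1.le, hτ.2⟩
  have h1 := ((hd τ hτ').hasDerivWithinAt).mono (Icc_subset_Icc_right hτ.2)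
  have h2 : HasDerivWithinAt t 0 (Icc 0 τ) τ := by
    refine (hasDerivWithinAt_const τ (Icc 0 τ) (t 0)).congr (fun σ hσ => ?_) h
    have hσ' : σ ∈ Icc (0 : ℝ) 1 := ⟨hσ.1, hσ.2.trans hτ.2⟩
    exact le_antisymm ((hm hσ' hτ' hσ.2).trans h.le) (hm ⟨le_rfl, zero_le_one⟩ hσ' hσ.1)
  exact (uniqueDiffOn_Icc hτ.1 τ ⟨hτ.1.le, le_rfl⟩).eq_deriv _ h1 h2

/-- Away from one point, a monotone function on `[0, 1]` either is locally constant or is locally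
bounded away from its initial value. -/
lemma exists_eventually_dichotomy {t : ℝ → ℝ} (hd : DifferentiableOn ℝ t (Icc 0 1))
    (hm : MonotoneOn t (Icc 0 1)) {τ : ℝ} (hτ : τ ∈ Ioo (0 : ℝ) 1)
    (hne : τ ≠ sSup {σ | σ ∈ Icc (0 : ℝ) 1 ∧ t σ = t 0}) :
    ∀ᶠ ε in nhdsWithin (0 : ℝ) (Ioi 0),
      (∀ σ ∈ Metric.ball τ ε, derivWithin t (Icc 0 1) σ = 0) ∨
        ∀ σ ∈ Metric.ball τ ε, t 0 + ε ≤ t σ := by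
  set A := {σ | σ ∈ Icc (0 : ℝ) 1 ∧ t σ = t 0} with hA
  have hA0 : A.Nonempty := ⟨0, ⟨le_rfl, zero_le_one⟩, rfl⟩
  have hAb : BddAbove A := ⟨1, fun σ hσ => hσ.1.2⟩
  have hsm : ∀ x : ℝ, 0 < x → ∀ᶠ ε in nhdsWithin (0 : ℝ) (Ioi 0), ε < x := fun x hx =>
    nhdsWithin_le_nhds (gt_mem_nhds hx)
  rcases lt_or_gt_of_ne hne with h | h
  -- Below the supremum some later `σ₀` still has the initial value, so monotonicity forces
  -- constancy around `τ`. Above it, a `σ₀` strictly between has a larger value, which bounds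
  -- everything near `τ` from below.
  · obtain ⟨σ₀, hσ₀, hlt⟩ := exists_lt_of_lt_csSup hA0 h
    filter_upwards [hsm (σ₀ - τ) (by linarith), hsm τ hτ.1] with ε h1 h2
    refine Or.inl fun σ hσ => ?_
    rw [Metric.mem_ball, Real.dist_eq, abs_lt] at hσ
    have hσ1 : σ ∈ Ioc (0 : ℝ) 1 := ⟨by linarith, by linarith [hσ₀.1.2]⟩
    refine derivWithin_eq_zero_of_eq hd hm hσ1 (le_antisymm ?_ ?_)
    · rw [← hσ₀.2]
      exact hm ⟨hσ1.1.le, hσ1.2⟩ hσ₀.1 (by linarith)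
    · exact hm ⟨le_rfl, zero_le_one⟩ ⟨hσ1.1.le, hσ1.2⟩ hσ1.1.le
  · obtain ⟨σ₀, h1, h2⟩ := exists_between h
    have hs0 : 0 ≤ sSup A := le_csSup hAb ⟨⟨le_rfl, zero_le_one⟩, rfl⟩
    have hσ₀ : σ₀ ∈ Icc (0 : ℝ) 1 := ⟨by linarith, by linarith [hτ.2]⟩
    have hpos : t 0 < t σ₀ := by
      refine lt_of_le_of_ne (hm ⟨le_rfl, zero_le_one⟩ hσ₀ hσ₀.1) fun he => ?_
      exact absurd (le_csSup hAb ⟨hσ₀, he.symm⟩) (not_le.2 h1)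
    filter_upwards [hsm (τ - σ₀) (by linarith), hsm (t σ₀ - t 0) (by linarith),
      hsm (1 - τ) (by linarith [hτ.2])] with ε e1 e2 e3
    refine Or.inr fun σ hσ => ?_
    rw [Metric.mem_ball, Real.dist_eq, abs_lt] at hσ
    have := hm hσ₀ (⟨by linarith [hσ₀.1], by linarith⟩ : σ ∈ Icc (0 : ℝ) 1) (by linarith)
    linarith

end Calculus

/-! ### Continuity and differentiability of the expected `logLik` along the path. -/

section Joint

variable {N : ℕ} {m : Fin N → ℕ}

/-- The expectation of `logLik` under the joint law. -/
noncomputable def expLogLik (π : (∀ ν, Fin (m ν) → ℝ) → ℝ) (p : ∀ ν, Fin (m ν) → ℝ)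
    (t : Fin N → ℝ) : ℝ :=
  ∑' z, jointMass t p z * logLik t π p z

lemma continuousOn_kern {q : ∀ ν, Fin (m ν) → ℝ} (hq : q ∈ paramSpace m) {t : Fin N → ℝ → ℝ}
    {S : Set ℝ} (ht : ∀ ν, ContinuousOn (t ν) S) (z : ∀ ν, Fin (m ν) → ℕ) :
    ContinuousOn (fun τ => kern (fun ν => t ν τ) q z) S := by
  unfold kern
  exact continuousOn_finsetProd _ fun ν _ => ContinuousOn.mul
    (ContinuousOn.rpow continuousOn_const (ht ν) fun _ _ => Or.inl (one_sub_pos hq ν).ne')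
    continuousOn_const

lemma continuousOn_jointCoeff {t : Fin N → ℝ → ℝ} {S : Set ℝ} (ht : ∀ ν, ContinuousOn (t ν) S)
    (z : ∀ ν, Fin (m ν) → ℕ) : ContinuousOn (fun τ => jointCoeff (fun ν => t ν τ) z) S := by
  unfold jointCoeff coeff
  exact continuousOn_finsetProd _ fun ν _ => ContinuousOn.div_const
    (continuousOn_finsetProd _ fun j _ => (ht ν).add continuousOn_const) _

namespace KernPrior

variable {r : Fin N → ℝ} {π : (∀ ν, Fin (m ν) → ℝ) → ℝ}

/-- Covers the points where differentiability may fail, including the start of the path: only the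
linear log bound is used, which needs no spare shape. -/
lemma continuousOn_expLogLik (h : KernPrior r π) (hr : ∀ ν, 0 < r ν) {p : ∀ ν, Fin (m ν) → ℝ}
    (hp : p ∈ paramSpace m) {t : Fin N → ℝ → ℝ} {T : Fin N → ℝ} {S : Set ℝ}
    (ht : ∀ ν, ContinuousOn (t ν) S) (hrt : ∀ τ ∈ S, r ≤ fun ν => t ν τ)
    (htT : ∀ τ ∈ S, (fun ν => t ν τ) ≤ T) (hrT : r ≤ T) :
    ContinuousOn (fun τ => expLogLik π p fun ν => t ν τ) S := by
  obtain ⟨C, hC0, hC⟩ := h.exists_log_bound (fun ν => (hr ν).le) hp T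
  have hT : ∀ ν, 0 < T ν := fun ν => (hr ν).trans_le (hrT ν)
  have ht0 : ∀ τ ∈ S, ∀ ν, 0 < t ν τ := fun τ hτ ν => (hr ν).trans_le (hrt τ hτ ν)
  refine continuousOn_tsum (u := fun z => C / kern T p (0 : ∀ ν, Fin (m ν) → ℕ) *
    (jointMass T p z * (1 + size z))) (fun z => ?_)
    ((summable_jointMass_mul_size hT hp).mul_left _) fun z τ hτ => ?_
  · refine ContinuousOn.mul ?_ (ContinuousOn.sub ?_ ?_)
    · refine ((continuousOn_jointCoeff ht z).mul (continuousOn_kern hp ht z)).congr fun τ hτ => ?_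
      exact jointMass_eq (ht0 τ hτ) p z
    · exact (continuousOn_kern hp ht z).log fun τ _ => (kern_pos hp _ _).ne'
    · exact (h.continuousOn_marg ht hrt z).log fun τ hτ => (h.marg_pos_of_le (hrt τ hτ) z).ne'
  · rw [norm_mul, Real.norm_of_nonneg (jointMass_pos (ht0 τ hτ) hp z).le]
    refine (mul_le_mul (jointMass_le (ht0 τ hτ) (htT τ hτ) hp z)
      (hC _ (hrt τ hτ) (htT τ hτ) z).2 (abs_nonneg _)
      (div_nonneg (jointMass_pos hT hp z).le (kern_pos hp _ _).le)).trans (le_of_eq ?_)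
    ring

lemma hasDerivAt_logLik (h : KernPrior r π) {p : ∀ ν, Fin (m ν) → ℝ}
    (hp : p ∈ paramSpace m) {t t' : Fin N → ℝ → ℝ} {U : Set ℝ} (hU : IsOpen U)
    (ht : ∀ ν, ∀ τ ∈ U, HasDerivAt (t ν) (t' ν τ) τ) (hrt : ∀ τ ∈ U, r ≤ fun ν => t ν τ)
    {C δ : ℝ} (hδ : 0 < δ) (hC : ∀ ν, ∀ τ ∈ U, |t' ν τ| ≤ C)
    (hact : ∀ ν, (∀ τ ∈ U, t' ν τ = 0) ∨ ∀ τ ∈ U, r ν + δ ≤ t ν τ)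
    (z : ∀ ν, Fin (m ν) → ℕ) {τ : ℝ} (hτ : τ ∈ U) :
    HasDerivAt (fun τ => logLik (fun ν => t ν τ) π p z)
      (∑ ν, t' ν τ * scoreDiff (fun ν => t ν τ) π p ν z) τ := by
  have hk := (hasDerivAt_kern hp (fun ν => ht ν τ hτ) z).log (kern_pos hp _ _).ne'
  have hm := (h.hasDerivAt_marg hU ht hrt hδ hC hact z hτ).log (h.marg_pos_of_le (hrt τ hτ) z).ne'
  refine (hk.sub hm).congr_deriv ?_
  have h1 := (kern_pos hp (fun ν => t ν τ) z).ne'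
  rw [neg_div, neg_div, Finset.sum_div, Finset.sum_div, neg_sub_neg, ← Finset.sum_sub_distrib]
  refine Finset.sum_congr rfl fun ν _ => ?_
  rw [scoreDiff]
  field_simp
  ring

lemma exists_derivTerm_bound (h : KernPrior r π) (hr : ∀ ν, 0 < r ν) {p : ∀ ν, Fin (m ν) → ℝ}
    (hp : p ∈ paramSpace m) (T : Fin N → ℝ) {δ : ℝ} (hδ : 0 < δ) :
    ∃ K : ℝ, 0 ≤ K ∧ ∀ t, r ≤ t → t ≤ T → ∀ ν, r ν + δ ≤ t ν → ∀ z : ∀ ν, Fin (m ν) → ℕ,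
      |derivTerm t π p ν z| ≤ K * (jointMass (T + 1) p z * (1 + size z)) := by
  obtain ⟨C₁, hC₁0, hC₁⟩ := h.exists_log_bound (fun ν => (hr ν).le) hp T
  obtain ⟨C₂, hC₂⟩ := h.exists_logMarg_bound (fun ν => (hr ν).le) hp T hδ
  set k₀ := kern (T + 1) p (0 : ∀ ν, Fin (m ν) → ℕ) with hk₀
  have hk₀p : 0 < k₀ := kern_pos hp _ _
  set B := ∑ ν, |Real.log (1 - ∑ i, p ν i)| with hB
  have hB0 : 0 ≤ B := Finset.sum_nonneg fun _ _ => abs_nonneg _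
  have hBν : ∀ ν, |Real.log (1 - ∑ i, p ν i)| ≤ B := fun ν =>
    Finset.single_le_sum (f := fun ν => |Real.log (1 - ∑ i, p ν i)|) (fun _ _ => abs_nonneg _)
      (Finset.mem_univ ν)
  refine ⟨(B + 1) / k₀ * C₁ + (B + |C₂|) / k₀, by positivity, fun t hrt htT ν hν z => ?_⟩
  have ht : ∀ ν, 0 < t ν := fun ν => (hr ν).trans_le (hrt ν)
  have htT1 : t ≤ T + 1 := htT.trans fun j => by simp
  have hT1 : ∀ ν, 0 < (T + 1) ν := fun j => (ht j).trans_le (htT1 j)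
  have hJ := jointMass_pos hT1 hp z
  have hs : 0 ≤ 1 + size z := by linarith [size_nonneg z]
  have b1 : |massDeriv t p ν z| ≤ (B + 1) / k₀ * jointMass (T + 1) p z := by
    refine (abs_massDeriv_le ht htT hp ν z).trans ?_
    have := hBν ν
    gcongr
  have b2 := (hC₁ t hrt htT z).2
  have b3 : |scoreDiff t π p ν z| ≤ (B + |C₂|) * (1 + size z) := by
    rw [scoreDiff]
    refine (abs_add_le _ _).trans ?_
    have e1 := hC₂ t hrt htT ν hν z
    have e2 := mul_le_mul_of_nonneg_right (le_abs_self C₂) hs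
    have e3 : B ≤ B * (1 + size z) := le_mul_of_one_le_right hB0 (by linarith [size_nonneg z])
    linarith [hBν ν]
  have b4 := jointMass_le ht htT1 hp z
  rw [derivTerm]
  refine (abs_add_le _ _).trans ?_
  rw [abs_mul, abs_mul, abs_of_pos (jointMass_pos ht hp z)]
  have c1 := mul_le_mul b1 b2 (abs_nonneg _) (by positivity)
  have c2 := mul_le_mul b4 b3 (abs_nonneg _) (by positivity)
  calc _ ≤ _ := add_le_add c1 c2
    _ = _ := by ring

/-- Termwise differentiation under the majorant at shape `T + 1`; the moving blocks then contribute
by `hasSum_degreeTerm`, the others contribute zero. -/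
lemma hasDerivAt_expLogLik (h : KernPrior r π) (hr : ∀ ν, 0 < r ν) {p : ∀ ν, Fin (m ν) → ℝ}
    (hp : p ∈ paramSpace m) {t t' : Fin N → ℝ → ℝ} {T : Fin N → ℝ} {U : Set ℝ} (hU : IsOpen U)
    (hUc : IsPreconnected U)
    (ht : ∀ ν, ∀ τ ∈ U, HasDerivAt (t ν) (t' ν τ) τ) (hrt : ∀ τ ∈ U, r ≤ fun ν => t ν τ)
    (htT : ∀ τ ∈ U, (fun ν => t ν τ) ≤ T)
    {C δ : ℝ} (hδ : 0 < δ) (hC : ∀ ν, ∀ τ ∈ U, |t' ν τ| ≤ C)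
    (hact : ∀ ν, (∀ τ ∈ U, t' ν τ = 0) ∨ ∀ τ ∈ U, r ν + δ ≤ t ν τ) {τ : ℝ} (hτ : τ ∈ U) :
    HasDerivAt (fun τ => expLogLik π p fun ν => t ν τ)
      (∑ ν, t' ν τ * ∑' k : ℕ, degreeTerm (fun ν => t ν τ) π p ν (k + 1)) τ := by
  have ht0 : ∀ τ ∈ U, ∀ ν, 0 < t ν τ := fun τ hτ ν => (hr ν).trans_le (hrt τ hτ ν)
  have hT1 : ∀ ν, 0 < (T + 1) ν := fun ν => (ht0 τ hτ ν).trans_le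
    ((htT τ hτ ν).trans (by simp))
  obtain ⟨C₁, hC₁0, hC₁⟩ := h.exists_log_bound (fun ν => (hr ν).le) hp T
  obtain ⟨K, hK0, hK⟩ := h.exists_derivTerm_bound hr hp T hδ
  have hd : ∀ z, ∀ τ ∈ U, HasDerivAt
      (fun τ => jointMass (fun ν => t ν τ) p z * logLik (fun ν => t ν τ) π p z)
      (∑ ν, t' ν τ * derivTerm (fun ν => t ν τ) π p ν z) τ := by
    intro z τ hτ
    refine ((hasDerivAt_jointMass hU ht (fun ν τ hτ => ht0 τ hτ ν) hp z hτ).mul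
      (h.hasDerivAt_logLik hp hU ht hrt hδ hC hact z hτ)).congr_deriv ?_
    rw [Finset.sum_mul, Finset.mul_sum, ← Finset.sum_add_distrib]
    refine Finset.sum_congr rfl fun ν _ => ?_
    rw [derivTerm]; ring
  have hb : ∀ z, ∀ τ ∈ U, ‖∑ ν, t' ν τ * derivTerm (fun ν => t ν τ) π p ν z‖ ≤
      ∑ _ν : Fin N, C * (K * (jointMass (T + 1) p z * (1 + size z))) := by
    intro z τ hτ
    refine (norm_sum_le _ _).trans (Finset.sum_le_sum fun ν _ => ?_)
    have hC0 : 0 ≤ C := (abs_nonneg _).trans (hC ν τ hτ)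
    have hJ := jointMass_pos hT1 hp z
    have hs : 0 ≤ 1 + size z := by linarith [size_nonneg z]
    rw [norm_mul]
    rcases hact ν with h0 | h0
    · rw [h0 τ hτ, norm_zero, zero_mul]; positivity
    · exact mul_le_mul (hC ν τ hτ) (hK _ (hrt τ hτ) (htT τ hτ) ν (h0 τ hτ) z) (norm_nonneg _) hC0
  have hu : Summable fun z : ∀ ν, Fin (m ν) → ℕ =>
      ∑ _ν : Fin N, C * (K * (jointMass (T + 1) p z * (1 + size z))) :=
    summable_sum fun _ _ => ((summable_jointMass_mul_size hT1 hp).mul_left K).mul_left C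
  have hg0 : Summable fun z =>
      jointMass (fun ν => t ν τ) p z * logLik (fun ν => t ν τ) π p z :=
    summable_of_linear_growth (ht0 τ hτ) hp fun z => (hC₁ _ (hrt τ hτ) (htT τ hτ) z).2
  have key := hasDerivAt_tsum_of_isPreconnected hu hU hUc hd hb hτ hg0 hτ
  refine key.congr_deriv ?_
  have hν : ∀ ν, HasSum (fun z => t' ν τ * derivTerm (fun ν => t ν τ) π p ν z)
      (t' ν τ * ∑' k : ℕ, degreeTerm (fun ν => t ν τ) π p ν (k + 1)) := by
    intro ν
    rcases hact ν with h0 | h0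
    · simp only [h0 τ hτ, zero_mul]; exact hasSum_zero
    · obtain ⟨a, ha1, ha2⟩ := h.hasSum_degreeTerm (fun ν => (hr ν).le) (ht0 τ hτ) (hrt τ hτ) hp hδ
        (h0 τ hτ)
      rw [ha2.tsum_eq]
      exact ha1.mul_left _
  exact (hasSum_sum fun ν _ => hν ν).tsum_eq

end KernPrior

end Joint

/-! ### The risk as an increment of the expected `logLik`. -/

section Risk

variable {N n : ℕ} {m : Fin N → ℕ}

/-- Extension of a shape vector of the first `n` blocks by zero. -/
noncomputable def extendShape (s : Fin n → ℝ) (ν : Fin N) : ℝ :=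
  if h : (ν : ℕ) < n then s ⟨ν, h⟩ else 0

/-- Extension of an observation of the first `n` blocks by zero. -/
def extendObs (hn : n ≤ N) (y : ∀ ν : Fin n, Fin (m (Fin.castLE hn ν)) → ℕ) :
    ∀ ν, Fin (m ν) → ℕ :=
  fun ν => if h : (ν : ℕ) < n then y ⟨ν, h⟩ else 0

@[simp] lemma extendShape_castLE (hn : n ≤ N) (s : Fin n → ℝ) (ν : Fin n) :
    extendShape s (Fin.castLE hn ν) = s ν := by
  simp [extendShape]

@[simp] lemma extendObs_castLE (hn : n ≤ N) (y : ∀ ν : Fin n, Fin (m (Fin.castLE hn ν)) → ℕ)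
    (ν : Fin n) : extendObs hn y (Fin.castLE hn ν) = y ν := by
  have h : ((Fin.castLE hn ν : Fin N) : ℕ) < n := ν.2
  unfold extendObs
  rw [dif_pos h]
  rfl

lemma not_lt_of_notMem_range (hn : n ≤ N) {ν : Fin N} (h : ν ∉ Set.range (Fin.castLE hn)) :
    ¬ (ν : ℕ) < n := fun hlt => h ⟨⟨ν, hlt⟩, rfl⟩

lemma extendShape_of_notMem (hn : n ≤ N) (s : Fin n → ℝ) {ν : Fin N}
    (h : ν ∉ Set.range (Fin.castLE hn)) : extendShape s ν = 0 :=
  dif_neg (not_lt_of_notMem_range hn h)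

lemma extendObs_of_notMem (hn : n ≤ N) (y : ∀ ν : Fin n, Fin (m (Fin.castLE hn ν)) → ℕ)
    {ν : Fin N} (h : ν ∉ Set.range (Fin.castLE hn)) : extendObs hn y ν = 0 :=
  dif_neg (not_lt_of_notMem_range hn h)

lemma extendObs_injective (hn : n ≤ N) : Function.Injective (extendObs (m := m) hn) :=
  fun y y' h => by
    ext1 ν
    rw [← extendObs_castLE hn y, h, extendObs_castLE]

lemma extendObs_le_iff (hn : n ≤ N) {y : ∀ ν : Fin n, Fin (m (Fin.castLE hn ν)) → ℕ}
    {z : ∀ ν, Fin (m ν) → ℕ} :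
    extendObs hn y ≤ z ↔ y ≤ fun ν => z (Fin.castLE hn ν) := by
  constructor
  · intro h ν
    rw [← extendObs_castLE hn y]
    exact h _
  · intro h ν
    by_cases hν : ν ∈ Set.range (Fin.castLE hn)
    · obtain ⟨μ, rfl⟩ := hν
      rw [extendObs_castLE]
      exact h μ
    · rw [extendObs_of_notMem hn y hν]
      exact zero_le

lemma kern_firstBlocks (hn : n ≤ N) (s : Fin n → ℝ) (q : ∀ ν, Fin (m ν) → ℝ)
    (y : ∀ ν : Fin n, Fin (m (Fin.castLE hn ν)) → ℕ) :
    kern s (firstBlocks hn q) y = kern (extendShape s) q (extendObs hn y) := by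
  refine Fintype.prod_of_injective (Fin.castLE hn) (Fin.castLE_injective hn) _ _
    (fun ν hν => ?_) fun ν => ?_
  · simp [extendShape_of_notMem hn s hν, extendObs_of_notMem hn y hν]
  · simp [firstBlocks]

lemma jointCoeff_extend (hn : n ≤ N) (s : Fin n → ℝ)
    (y : ∀ ν : Fin n, Fin (m (Fin.castLE hn ν)) → ℕ) :
    jointCoeff s y = jointCoeff (extendShape s) (extendObs hn y) := by
  refine Fintype.prod_of_injective (Fin.castLE hn) (Fin.castLE_injective hn) _ _
    (fun ν hν => ?_) fun ν => ?_
  · simp [extendObs_of_notMem hn y hν]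
  · simp

lemma size_extendObs (hn : n ≤ N) (y : ∀ ν : Fin n, Fin (m (Fin.castLE hn ν)) → ℕ) :
    size (extendObs hn y) = size y := by
  symm
  refine Fintype.sum_of_injective (Fin.castLE hn) (Fin.castLE_injective hn) _ _
    (fun ν hν => ?_) fun ν => ?_
  · simp [extendObs_of_notMem hn y hν]
  · simp

lemma coeff_zero_left {k : ℕ} {z : Fin k → ℕ} (hz : z ≠ 0) : coeff 0 z = 0 := by
  have : ∑ i, z i ≠ 0 := fun h => hz (by
    ext j; simpa using (Finset.sum_eq_zero_iff.1 h) j (Finset.mem_univ j))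
  rw [coeff, Finset.prod_eq_zero (Finset.mem_range.2 (Nat.pos_of_ne_zero this)) (by simp), zero_div]

lemma sum_jointCoeff_mul_jointCoeff (s t : Fin N → ℝ) (z : ∀ ν, Fin (m ν) → ℕ) :
    ∑ x ∈ Finset.Iic z, jointCoeff s x * jointCoeff t (z - x) = jointCoeff (s + t) z := by
  have hI : Finset.Iic z = Fintype.piFinset fun ν => Finset.Iic (z ν) := by
    ext x; simp [Pi.le_def]
  have h := Finset.prod_univ_sum (fun ν => Finset.Iic (z ν))
    fun ν x => coeff (s ν) x * coeff (t ν) (z ν - x)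
  rw [hI, jointCoeff]
  simp only [sum_coeff_mul_coeff] at h
  refine Eq.trans ?_ h.symm
  exact Finset.sum_congr rfl fun x _ => by
    rw [jointCoeff, jointCoeff, ← Finset.prod_mul_distrib]; rfl

lemma sum_jointCoeff_extend (hn : n ≤ N) (s : Fin n → ℝ) (r : Fin N → ℝ)
    (z : ∀ ν, Fin (m ν) → ℕ) :
    ∑ y ∈ Finset.Iic (fun ν => z (Fin.castLE hn ν)),
      jointCoeff s y * jointCoeff r (z - extendObs hn y) =
      jointCoeff (r + extendShape s) z := by
  rw [add_comm, ← sum_jointCoeff_mul_jointCoeff]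
  refine Finset.sum_of_injOn (extendObs hn) (extendObs_injective hn).injOn ?_ ?_ ?_
  · intro y hy
    simp only [Finset.coe_Iic, Set.mem_Iic] at hy ⊢
    exact (extendObs_le_iff hn).2 hy
  · intro x hx hx'
    -- Shape zero is the point mass at zero: a nonzero entry outside the first `n` blocks kills the
    -- coefficient.
    suffices h : ∃ ν, ν ∉ Set.range (Fin.castLE hn) ∧ x ν ≠ 0 by
      obtain ⟨ν, hν, hxν⟩ := h
      rw [jointCoeff, Finset.prod_eq_zero (Finset.mem_univ ν), zero_mul]
      rw [extendShape_of_notMem hn s hν, coeff_zero_left hxν]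
    by_contra hcon
    push Not at hcon
    apply hx'
    have he : extendObs hn (fun ν => x (Fin.castLE hn ν)) = x := by
      ext1 ν
      by_cases hν : ν ∈ Set.range (Fin.castLE hn)
      · obtain ⟨μ, rfl⟩ := hν
        rw [extendObs_castLE]
      · rw [extendObs_of_notMem hn _ hν, hcon ν hν]
    refine ⟨fun ν => x (Fin.castLE hn ν), ?_, he⟩
    simp only [Finset.coe_Iic, Set.mem_Iic]
    rw [← extendObs_le_iff, he]
    exact Finset.mem_Iic.1 hx
  · intro y _
    rw [jointCoeff_extend hn]

lemma firstBlocks_mem (hn : n ≤ N) {p : ∀ ν, Fin (m ν) → ℝ} (hp : p ∈ paramSpace m) :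
    firstBlocks hn p ∈ paramSpace fun ν => m (Fin.castLE hn ν) := fun _ => hp _

lemma sum_jointMass_extend (hn : n ≤ N) {s : Fin n → ℝ} (hs : ∀ ν, 0 < s ν) {r : Fin N → ℝ}
    (hr : ∀ ν, 0 < r ν) (hrs : ∀ ν, 0 < (r + extendShape s : Fin N → ℝ) ν) {p : ∀ ν, Fin (m ν) → ℝ}
    (hp : p ∈ paramSpace m) (z : ∀ ν, Fin (m ν) → ℕ) :
    ∑ y ∈ Finset.Iic (fun ν => z (Fin.castLE hn ν)),
      jointMass s (firstBlocks hn p) y * jointMass r p (z - extendObs hn y) =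
      jointMass (r + extendShape s) p z := by
  rw [jointMass_eq hrs, ← sum_jointCoeff_extend hn, Finset.sum_mul]
  refine Finset.sum_congr rfl fun y hy => ?_
  have hle := (extendObs_le_iff hn).2 (Finset.mem_Iic.1 hy)
  have hk := kern_add hp r (extendShape s) (z - extendObs hn y) (extendObs hn y)
  rw [tsub_add_cancel_of_le hle] at hk
  rw [jointMass_eq hs, jointMass_eq hr, kern_firstBlocks, hk]
  ring

lemma predMass_eq (hn : n ≤ N) {s : Fin n → ℝ} (hs : ∀ ν, 0 < s ν) {r : Fin N → ℝ}
    (hr : ∀ ν, 0 < r ν) (π : (∀ ν, Fin (m ν) → ℝ) → ℝ)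
    (y : ∀ ν : Fin n, Fin (m (Fin.castLE hn ν)) → ℕ) (x : ∀ ν, Fin (m ν) → ℕ) :
    predMass hn r s π y x =
      jointCoeff s y * (marg (r + extendShape s) π (x + extendObs hn y) / marg r π x) := by
  rw [predMass, postMean_eq hr, ← mul_div_assoc]
  congr 1
  rw [marg, ← integral_const_mul]
  refine setIntegral_congr_fun measurableSet_paramSpace fun q hq => ?_
  simp only [jointMass_eq hs, kern_firstBlocks, kern_add hq]
  ring

/-- The coefficient of `y` cancels, and the kernel is multiplicative in shape and observation
jointly, so the ratio depends on the data only through `x` and the total `x + y`. -/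
lemma logRatio_eq (hn : n ≤ N) {s : Fin n → ℝ} (hs : ∀ ν, 0 < s ν) {r : Fin N → ℝ}
    (hr : ∀ ν, 0 < r ν) {π : (∀ ν, Fin (m ν) → ℝ) → ℝ} (h : KernPrior r π)
    (hrs : r ≤ r + extendShape s) {p : ∀ ν, Fin (m ν) → ℝ} (hp : p ∈ paramSpace m)
    (x : ∀ ν, Fin (m ν) → ℕ) (y : ∀ ν : Fin n, Fin (m (Fin.castLE hn ν)) → ℕ) :
    logRatio hn r s π p (x, y) =
      logLik (r + extendShape s) π p (x + extendObs hn y) - logLik r π p x := by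
  have h1 := (h.marg_pos_of_le le_rfl x).ne'
  have h2 := (h.marg_pos_of_le hrs (x + extendObs hn y)).ne'
  have h3 := (kern_pos hp (extendShape s) (extendObs hn y)).ne'
  have h4 := (jointCoeff_pos hs y).ne'
  have h5 := (kern_pos hp r x).ne'
  rw [logRatio, predMass_eq hn hs hr, jointMass_eq hs, kern_firstBlocks,
    mul_div_mul_left _ _ h4, Real.log_div h3 (div_ne_zero h2 h1), Real.log_div h2 h1, logLik, logLik,
    kern_add hp, Real.log_mul h5 h3]
  ring

lemma obsLaw_singleton (hn : n ≤ N) {s : Fin n → ℝ} (hs : ∀ ν, 0 < s ν) {r : Fin N → ℝ}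
    (hr : ∀ ν, 0 < r ν) {p : ∀ ν, Fin (m ν) → ℝ} (hp : p ∈ paramSpace m)
    (xy : (∀ ν, Fin (m ν) → ℕ) × (∀ ν : Fin n, Fin (m (Fin.castLE hn ν)) → ℕ)) :
    obsLaw hn r s p {xy} =
      ENNReal.ofReal (jointMass r p xy.1 * jointMass s (firstBlocks hn p) xy.2) := by
  have h1 : SigmaFinite (jointLaw s (firstBlocks hn p)) := by unfold jointLaw; infer_instance
  obtain ⟨x, y⟩ := xy
  rw [obsLaw, ← Set.singleton_prod_singleton, Measure.prod_prod, jointLaw_singleton hr hp,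
    jointLaw_singleton hs (firstBlocks_mem hn hp),
    ENNReal.ofReal_mul (jointMass_pos hr hp x).le]

/-- The risk is finite, and is the increment of the expected `logLik`. -/
lemma integrable_logRatio_and_risk_eq (hn : n ≤ N) {s : Fin n → ℝ} (hs : ∀ ν, 0 < s ν)
    {r : Fin N → ℝ} (hr : ∀ ν, 0 < r ν) {π : (∀ ν, Fin (m ν) → ℝ) → ℝ} (h : KernPrior r π)
    {p : ∀ ν, Fin (m ν) → ℝ} (hp : p ∈ paramSpace m) :
    Integrable (logRatio hn r s π p) (obsLaw hn r s p) ∧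
      risk hn r s π p = expLogLik π p (r + extendShape s) - expLogLik π p r := by
  have hrs : r ≤ r + extendShape s := by
    intro ν
    rw [Pi.add_apply, extendShape]
    split_ifs with hν
    · linarith [hs ⟨ν, hν⟩]
    · simp
  have hrs0 : ∀ ν, 0 < (r + extendShape s : Fin N → ℝ) ν := fun ν => (hr ν).trans_le (hrs ν)
  have hp' := firstBlocks_mem hn hp
  obtain ⟨C, hC0, hC⟩ := h.exists_log_bound (fun ν => (hr ν).le) hp (r + extendShape s)
  have hJr := hasSum_jointMass hr hp
  have hJs := hasSum_jointMass hs hp'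
  have hr0 : ∀ x, 0 ≤ jointMass r p x := fun x => (jointMass_pos hr hp x).le
  have hs0 : ∀ y, 0 ≤ jointMass s (firstBlocks hn p) y := fun y => (jointMass_pos hs hp' y).le
  have hmass0 : ∀ xy : (∀ ν, Fin (m ν) → ℕ) × (∀ ν : Fin n, Fin (m (Fin.castLE hn ν)) → ℕ),
      0 ≤ jointMass r p xy.1 * jointMass s (firstBlocks hn p) xy.2 := fun xy =>
    mul_nonneg (hr0 _) (hs0 _)
  have sr : Summable fun x => jointMass r p x * logLik r π p x :=
    summable_of_linear_growth hr hp fun x => (hC r le_rfl hrs x).2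
  have st : Summable fun x => jointMass (r + extendShape s) p x *
      logLik (r + extendShape s) π p x :=
    summable_of_linear_growth hrs0 hp fun x => (hC _ hrs le_rfl x).2
  -- the first observation
  have q1 := hasSum_mul_prod sr.hasSum hJs
  -- the total observation
  set f : (∀ ν : Fin n, Fin (m (Fin.castLE hn ν)) → ℕ) → (∀ ν, Fin (m ν) → ℕ) → ℝ := fun y x =>
    jointMass r p x * jointMass s (firstBlocks hn p) y *
      logLik (r + extendShape s) π p (x + extendObs hn y) with hf
  have hb : ∀ y x, |f y x| ≤ C * (jointMass s (firstBlocks hn p) y * (1 + size y) *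
      (jointMass r p x * (1 + size x))) := by
    intro y x
    simp only [hf]
    rw [abs_mul, abs_of_nonneg (mul_nonneg (hr0 x) (hs0 y))]
    have e1 := (hC _ hrs le_rfl (x + extendObs hn y)).2
    rw [size_add, size_extendObs] at e1
    have e2 : C * (1 + (size x + size y)) ≤ C * ((1 + size x) * (1 + size y)) := by
      refine mul_le_mul_of_nonneg_left ?_ hC0
      nlinarith [mul_nonneg (size_nonneg x) (size_nonneg y)]
    refine (mul_le_mul_of_nonneg_left (e1.trans e2) (mul_nonneg (hr0 x) (hs0 y))).trans
      (le_of_eq ?_)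
    ring
  have hsum := hasSum_mul_prod (summable_jointMass_mul_size hs hp').hasSum
    (summable_jointMass_mul_size hr hp).hasSum
  have hfs : Summable fun yx : (∀ ν : Fin n, Fin (m (Fin.castLE hn ν)) → ℕ) ×
      (∀ ν, Fin (m ν) → ℕ) => f yx.1 yx.2 :=
    Summable.of_norm_bounded (hsum.summable.mul_left C) fun yx => hb yx.1 yx.2
  -- Summing over the value of the total turns the product law into the law with shape `r + s`.
  have hconv := hasSum_sum_sub (extendObs hn) (fun z => Finset.Iic fun ν => z (Fin.castLE hn ν))
    (fun z y => by rw [Finset.mem_Iic, extendObs_le_iff]) hfs.hasSum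
  have hval : ∀ z, ∑ y ∈ Finset.Iic (fun ν => z (Fin.castLE hn ν)), f y (z - extendObs hn y) =
      jointMass (r + extendShape s) p z * logLik (r + extendShape s) π p z := by
    intro z
    rw [← sum_jointMass_extend hn hs hr hrs0 hp, Finset.sum_mul]
    refine Finset.sum_congr rfl fun y hy => ?_
    simp only [hf]
    rw [tsub_add_cancel_of_le ((extendObs_le_iff hn).2 (Finset.mem_Iic.1 hy))]
    ring
  have htot := (hasSum_of_eq hconv fun z => (hval z).symm).unique st.hasSum
  have q2 : HasSum (fun xy : (∀ ν, Fin (m ν) → ℕ) ×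
      (∀ ν : Fin n, Fin (m (Fin.castLE hn ν)) → ℕ) => f xy.2 xy.1)
      (expLogLik π p (r + extendShape s)) := by
    have h0 := hfs.hasSum
    rw [htot] at h0
    exact hasSum_swap (f := fun x y => f y x) h0
  have q3 := q2.sub q1
  have hfin : HasSum (fun xy => jointMass r p xy.1 * jointMass s (firstBlocks hn p) xy.2 *
      logRatio hn r s π p xy) (expLogLik π p (r + extendShape s) - expLogLik π p r) := by
    rw [mul_one] at q3
    refine hasSum_of_eq q3 ?_
    rintro ⟨x, y⟩
    rw [logRatio_eq hn hs hr h hrs hp]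
    simp only [hf]
    ring
  refine ⟨(integrable_iff_summable hmass0 (obsLaw_singleton hn hs hr hp) _).2 hfin.summable, ?_⟩
  rw [risk, integral_eq_tsum hmass0 (obsLaw_singleton hn hs hr hp), hfin.tsum_eq]

end Risk

end NegMult

theorem mainTheorem7 (N n : ℕ) (hn1 : 1 ≤ n) (hn : n ≤ N) (m : Fin N → ℕ) (hm : ∀ ν, 1 ≤ m ν)
    (r : Fin N → ℝ) (hr : ∀ ν, 0 < r ν) (s : Fin n → ℝ) (hs : ∀ ν, 0 < s ν)
    (p : ∀ ν, Fin (m ν) → ℝ) (hp : p ∈ NegMult.paramSpace m)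
    (π : (∀ ν, Fin (m ν) → ℝ) → ℝ) (hπ : NegMult.IsPrior r π)
    (t : Fin N → ℝ → ℝ)
    (ht_smooth : ∀ ν, ContDiffOn ℝ ∞ (t ν) (Icc 0 1))
    (ht_mono : ∀ ν, MonotoneOn (t ν) (Icc 0 1))
    (ht0 : ∀ ν, t ν 0 = r ν)
    (ht1 : ∀ ν : Fin N, t ν 1 = if h : (ν : ℕ) < n then r ν + s ⟨ν, h⟩ else r ν) :
    -- the risk is a genuine, finite expectation
    Integrable (NegMult.logRatio hn r s π p) (NegMult.obsLaw hn r s p) ∧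
    -- the posteriors given `Z(τ)` are proper
    (∀ τ ∈ Icc (0 : ℝ) 1, NegMult.IsPrior (fun ν => t ν τ) π) ∧
    -- the risks of the Bayes estimators of the monomials are finite
    (∀ τ ∈ Icc (0 : ℝ) 1, ∀ (ν : Fin n) (w : Fin (m (Fin.castLE hn ν)) → ℕ),
      Integrable (NegMult.monomialLoss (fun ν' => t ν' τ) π p (Fin.castLE hn ν) w)
        (NegMult.jointLaw (fun ν' => t ν' τ) p)) ∧
    -- the series over the degree converges
    (∀ τ ∈ Ioc (0 : ℝ) 1, ∀ ν : Fin n,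
      derivWithin (t (Fin.castLE hn ν)) (Icc 0 1) τ ≠ 0 →
        Summable (fun k : ℕ =>
          NegMult.degreeTerm (fun ν' => t ν' τ) π p (Fin.castLE hn ν) (k + 1))) ∧
    -- the integrand is integrable
    IntervalIntegrable (fun τ : ℝ => ∑ ν : Fin n,
      derivWithin (t (Fin.castLE hn ν)) (Icc 0 1) τ *
        ∑' k : ℕ, NegMult.degreeTerm (fun ν' => t ν' τ) π p (Fin.castLE hn ν) (k + 1))
      volume 0 1 ∧
    NegMult.risk hn r s π p =
      ∫ τ in (0 : ℝ)..1, ∑ ν : Fin n,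
        derivWithin (t (Fin.castLE hn ν)) (Icc 0 1) τ *
          ∑' k : ℕ, NegMult.degreeTerm (fun ν' => t ν' τ) π p (Fin.castLE hn ν) (k + 1) := by
  have hK := hπ.kernPrior hr
  have htd : ∀ ν, DifferentiableOn ℝ (t ν) (Icc 0 1) := fun ν =>
    (ht_smooth ν).differentiableOn (by simp)
  have h01 : (0 : ℝ) ∈ Icc (0 : ℝ) 1 := ⟨le_rfl, zero_le_one⟩
  have h11 : (1 : ℝ) ∈ Icc (0 : ℝ) 1 := ⟨zero_le_one, le_rfl⟩
  have hrt : ∀ τ ∈ Icc (0 : ℝ) 1, r ≤ fun ν => t ν τ := fun τ hτ ν => by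
    rw [← ht0 ν]; exact ht_mono ν h01 hτ hτ.1
  have htT : ∀ τ ∈ Icc (0 : ℝ) 1, (fun ν => t ν τ) ≤ fun ν => t ν 1 := fun τ hτ ν =>
    ht_mono ν hτ h11 hτ.2
  have hpos : ∀ τ ∈ Icc (0 : ℝ) 1, ∀ ν, 0 < t ν τ := fun τ hτ ν => (hr ν).trans_le (hrt τ hτ ν)
  have hr0 : 0 ≤ r := fun ν => (hr ν).le
  have hts : (fun ν => t ν 1) = r + NegMult.extendShape s := by
    ext ν
    rw [ht1 ν, Pi.add_apply, NegMult.extendShape]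
    split_ifs <;> simp
  have htr : (fun ν => t ν 0) = r := funext ht0
  have hlast : ∀ ν, ν ∉ Set.range (Fin.castLE hn) → ∀ τ ∈ Ioc (0 : ℝ) 1,
      derivWithin (t ν) (Icc 0 1) τ = 0 := by
    intro ν hν τ hτ
    have hτ' : τ ∈ Icc (0 : ℝ) 1 := ⟨hτ.1.le, hτ.2⟩
    have h1 : t ν 1 = t ν 0 := by
      rw [ht1, ht0, dif_neg (NegMult.not_lt_of_notMem_range hn hν)]
    exact NegMult.derivWithin_eq_zero_of_eq (htd ν) (ht_mono ν) hτ
      (le_antisymm ((ht_mono ν hτ' h11 hτ.2).trans h1.le) (ht_mono ν h01 hτ' hτ.1.le))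
  obtain ⟨hint, hrisk⟩ := NegMult.integrable_logRatio_and_risk_eq hn hs hr hK hp
  set F : ℝ → ℝ := fun τ => NegMult.expLogLik π p fun ν => t ν τ with hF
  set g : ℝ → ℝ := fun τ : ℝ => ∑ ν : Fin n,
    derivWithin (t (Fin.castLE hn ν)) (Icc 0 1) τ *
      ∑' k : ℕ, NegMult.degreeTerm (fun ν' => t ν' τ) π p (Fin.castLE hn ν) (k + 1) with hg
  have hgN : ∀ τ ∈ Ioo (0 : ℝ) 1, g τ = ∑ ν : Fin N, derivWithin (t ν) (Icc 0 1) τ *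
      ∑' k : ℕ, NegMult.degreeTerm (fun ν' => t ν' τ) π p ν (k + 1) := by
    intro τ hτ
    refine Fintype.sum_of_injective (Fin.castLE hn) (Fin.castLE_injective hn) _ _
      (fun ν hν => ?_) fun ν => rfl
    rw [hlast ν hν τ ⟨hτ.1, hτ.2.le⟩, zero_mul]
  have hg0 : ∀ τ ∈ Ioo (0 : ℝ) 1, 0 ≤ g τ := by
    intro τ hτ
    have hτ' : τ ∈ Icc (0 : ℝ) 1 := ⟨hτ.1.le, hτ.2.le⟩
    exact Finset.sum_nonneg fun ν _ => mul_nonneg (ht_mono _).derivWithin_nonneg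
      (tsum_nonneg fun k => hK.degreeTerm_nonneg (hpos τ hτ') (hrt τ hτ') hp _ _)
  have hFc : ContinuousOn F (Icc 0 1) := hK.continuousOn_expLogLik hr hp
    (fun ν => (ht_smooth ν).continuousOn) hrt htT (hrt 1 h11)
  have hbd : ∃ C, ∀ ν, ∀ τ ∈ Icc (0 : ℝ) 1, |derivWithin (t ν) (Icc 0 1) τ| ≤ C := by
    have h1 : ∀ ν, ∃ C, ∀ τ ∈ Icc (0 : ℝ) 1, |derivWithin (t ν) (Icc 0 1) τ| ≤ C := fun ν =>
      isCompact_Icc.exists_bound_of_continuousOn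
        ((ht_smooth ν).continuousOn_derivWithin (uniqueDiffOn_Icc zero_lt_one) (by simp))
    choose C hC using h1
    refine ⟨∑ ν, |C ν|, fun ν τ hτ => (hC ν τ hτ).trans ((le_abs_self _).trans ?_)⟩
    exact Finset.single_le_sum (f := fun ν => |C ν|) (fun _ _ => abs_nonneg _) (Finset.mem_univ ν)
  obtain ⟨C, hC⟩ := hbd
  -- One exceptional point per block: the last time at which its shape has the initial value.
  let S : Finset ℝ := Finset.univ.image fun ν => sSup {σ | σ ∈ Icc (0 : ℝ) 1 ∧ t ν σ = t ν 0}
  have hd : ∀ τ ∈ Ioo (0 : ℝ) 1, τ ∉ S → HasDerivAt F (g τ) τ := by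
    intro τ hτ hτS
    have hev : ∀ᶠ ε in nhdsWithin (0 : ℝ) (Ioi 0), ∀ ν,
        (∀ σ ∈ Metric.ball τ ε, derivWithin (t ν) (Icc 0 1) σ = 0) ∨
          ∀ σ ∈ Metric.ball τ ε, t ν 0 + ε ≤ t ν σ :=
      Filter.eventually_all.2 fun ν => NegMult.exists_eventually_dichotomy (htd ν) (ht_mono ν) hτ
        fun he => hτS (Finset.mem_image.2 ⟨ν, Finset.mem_univ ν, he.symm⟩)
    have hsub : ∀ᶠ ε in nhdsWithin (0 : ℝ) (Ioi 0), Metric.ball τ ε ⊆ Ioo (0 : ℝ) 1 := by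
      obtain ⟨ε₀, hε₀, hb⟩ := Metric.isOpen_iff.1 isOpen_Ioo τ hτ
      filter_upwards [nhdsWithin_le_nhds (gt_mem_nhds hε₀)] with ε hε
      exact (Metric.ball_subset_ball hε.le).trans hb
    obtain ⟨ε, ⟨hdich, hball⟩, hε⟩ := ((hev.and hsub).and self_mem_nhdsWithin).exists
    have hball' : Metric.ball τ ε ⊆ Icc (0 : ℝ) 1 := hball.trans Ioo_subset_Icc_self
    rw [hgN τ hτ]
    -- The same `ε` is the radius of the neighbourhood and the spare shape of the moving blocks.
    refine hK.hasDerivAt_expLogLik hr hp (t' := fun ν => derivWithin (t ν) (Icc 0 1))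
      (T := fun ν => t ν 1) (U := Metric.ball τ ε) (C := C) (δ := ε) Metric.isOpen_ball
      (convex_ball τ ε).isPreconnected (fun ν σ hσ => ?_) (fun σ hσ => hrt σ (hball' hσ))
      (fun σ hσ => htT σ (hball' hσ)) hε (fun ν σ hσ => hC ν σ (hball' hσ)) (fun ν => ?_)
      (Metric.mem_ball_self hε)
    · exact ((htd ν σ (hball' hσ)).hasDerivWithinAt).hasDerivAt
        (Icc_mem_nhds (hball hσ).1 (hball hσ).2)
    · rw [← ht0 ν]; exact hdich ν
  have hgi : IntervalIntegrable g volume 0 1 :=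
    NegMult.intervalIntegrable_of_hasDerivAt_off_finite S zero_le_one hFc hg0 hd
  refine ⟨hint, fun τ hτ => hK.isPrior (hrt τ hτ) (hpos τ hτ), fun τ hτ ν w =>
    hK.integrable_monomialLoss hr0 (hpos τ hτ) (hrt τ hτ) hp _ w, fun τ hτ ν hne => ?_, hgi, ?_⟩
  · have hτ' : τ ∈ Icc (0 : ℝ) 1 := ⟨hτ.1.le, hτ.2⟩
    have hlt : r (Fin.castLE hn ν) < t (Fin.castLE hn ν) τ := by
      refine lt_of_le_of_ne (hrt τ hτ' _) fun he => hne ?_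
      exact NegMult.derivWithin_eq_zero_of_eq (htd _) (ht_mono _) hτ (he.symm.trans (ht0 _).symm)
    -- A nonzero derivative at `τ > 0` means the block has left its initial shape, so `δ = t τ - r`
    -- is available.
    obtain ⟨a, -, ha⟩ := hK.hasSum_degreeTerm hr0 (hpos τ hτ') (hrt τ hτ') hp (sub_pos.2 hlt)
      (add_sub_cancel _ _).le
    exact ha.summable
  · have hFTC := integral_eq_of_hasDerivAt_off_countable_of_le F g zero_le_one
      S.countable_toSet hFc (fun x hx => hd x hx.1 hx.2) hgi
    rw [hFTC, hrisk, hF, ← hts]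
    simp only [htr]
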